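/- Let $d\ge 1$, let $\zeta$ be a random variable with law $P$, let $f(x,\zeta)$, $x\in\mathbb R^d$, be real valued with $\mathbb E|f(x,\zeta)|<\infty$, and let $F(x)=\mathbb E_\zeta[f(x,\zeta)]$. Assume: (1) $F$ is $C^2$ and bounded below, and for every $\zeta$ the function $f(\cdot,\zeta)$ is $C^2$ with $\|\nabla f(x,\zeta)-\nabla f(y,\zeta)\|\le L_f\|x-y\|$ and $\|\nabla^2 f(x,\zeta)-\nabla^2 f(y,\zeta)\|\le M_f\|x-y\|$ for all $x,y$. (2) There are $\beta_1,\beta_2\ge 0$ with $\mathbb E_\zeta\|\nabla f(x,\zeta)-\nabla F(x)\|^2\le\beta_1\|\nabla F(x)\|^2+\beta_2$ for all $x$. Fix $\nu>0$, $\theta>0$, a starting point $x_0\in\mathbb R^d$, and deterministic step sizes $\alpha_k$ and numbers of directions $|T_k|\ge 1$. For a finite sample $S$ and a finite family of directions $T$ put $F_S=\frac1{|S|}\sum_{\zeta_i\in S}f(\cdot,\zeta_i)$ and $$g_{S,T}(x)=\gamma\sum_{u\in T}\frac{F_S(x+\nu u)-F_S(x-\nu u)}{2\nu}\,u ,\qquad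 x_{k+1}=x_k-\alpha_k\,g_{S_k,T_k}(x_k)\quad(k\ge 0),$$ and write $g_{\zeta,T}$ for $g_{\{\zeta\},T}$. One of the following methods is used at all iterations: cFD: $T_k=\{e_1,\dots,e_d\}$, $\gamma=1$; cGS: $T_k$ consists of independent $\mathcal N(0,I)$ vectors, $\gamma=1/|T_k|$; cSS: $T_k$ consists of independent vectors uniform on the unit sphere, $\gamma=d/|T_k|$; cRC: $T_k$ is a uniformly random set of $|T_k|$ distinct canonical vectors, $\gamma=d/|T_k|$; cRS: $T_k$ consists of random orthonormal vectors with $\mathbb E\big[\sum_{u\in T_k}uu^T\big]=\frac{|T_k|}{d}I$ (for instance a uniformly distributed orthonormal frame, or a uniformly random subset of a random orthonormal basis), $\gamma=d/|T_k|$. Let $\mathcal F_k$ be the $\sigma$-algebra generated by $T_j,S_j$ for $0\le j<k$, let $\mathcal F_{k+1/2}$ be generated by $\mathcal F_k$ and $T_k$, and write $\mathbb E_k=\mathbb E_{T_k}=\mathbb E[\,\cdot\mid\mathcal F_k]$ and $g_{T_k}(x_k)=\mathbb E[g_{S_k,T_k}(x_k)\mid\mathcal F_{k+1/2}]$. Assume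 (3) $T_k$ is independent of $\mathcal F_k$, the size $|S_k|\ge1$ is $\mathcal F_k$-measurable, and conditionally on $\mathcal F_{k+1/2}$ the set $S_k$ consists of $|S_k|$ i.i.d. samples of $\zeta$. Then $\nabla F$ and $\nabla^2F$ are Lipschitz with constants $L_f$ and $M_f$. Moreover, let $L_F>0$ and $M_F$ be any Lipschitz constants of $\nabla F$ and $\nabla^2F$, and put $\Omega_1=\frac{1}{4(1+\theta^2)L_F}$ and $\Omega_2=\frac{dM_F^2\nu^4}{48}$. Let $k\ge 0$ be such that the norm condition $$\frac{\mathbb E_{T_k}\big[\mathbb E_\zeta\|g_{\zeta,T_k}(x_k)-g_{T_k}(x_k)\|^2\big]}{|S_k|}\le\theta^2\,\mathbb E_{T_k}\|g_{T_k}(x_k)\|^2\quad\text{a.s.}$$ holds. If $0<\alpha_k\le\bar\alpha_k$, then $F(x_{k+1})$ is integrable and almost surely $$\mathbb E_k[F(x_{k+1})]\le F(x_k)-\frac{\alpha_k}{4}\|\nabla F(x_k)\|^2+\alpha_k\chi_k ,$$ where cFD: $\bar\alpha_k=\Omega_1$, $\chi_k=\Omega_2$; cGS: $\bar\alpha_k=\frac{|T_k|}{|T_k|+4.5d}\Omega_1$,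 $\chi_k=\frac{72|T_k|d+216d^2+(d+2)(d+4)(d+6)}{2(|T_k|+4.5d)}\Omega_2$; cSS: $\bar\alpha_k=\frac{|T_k|}{|T_k|+4.5d}\Omega_1$, $\chi_k=\frac{72|T_k|+216d+d^2}{2d(|T_k|+4.5d)}\Omega_2$; cRC and cRS: $\bar\alpha_k=\frac{|T_k|}{d}\Omega_1$, $\chi_k=\Omega_2$. Here $\bar\alpha_k>0$, and $\chi_k>0$ whenever $M_F>0$. -/

import Mathlib

open MeasureTheory ProbabilityTheory

namespace CFD

noncomputable section

/-- The space `ℝ^d` with the Euclidean norm. -/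
abbrev Vec (d : ℕ) : Type := EuclideanSpace ℝ (Fin d)

/-- The Hessian `∇²φ(x)`, as a linear operator; its norm is the spectral norm. -/
def hessian {d : ℕ} (φ : Vec d → ℝ) (x : Vec d) : Vec d →L[ℝ] Vec d :=
  fderiv ℝ (gradient φ) x

/-- `L` is a Lipschitz constant of the gradient of `φ`. -/
def GradLipschitz {d : ℕ} (φ : Vec d → ℝ) (L : ℝ) : Prop :=
  ∀ x y, ‖gradient φ x - gradient φ y‖ ≤ L * ‖x - y‖

/-- `M` is a Lipschitz constant of the Hessian of `φ`. -/
def HessLipschitz {d : ℕ} (φ : Vec d → ℝ) (M : ℝ) : Prop :=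
  ∀ x y, ‖hessian φ x - hessian φ y‖ ≤ M * ‖x - y‖

section Objective

variable {d : ℕ} {Ξ : Type*} [MeasurableSpace Ξ]

/-- The objective `F(x) = 𝔼_ζ[f(x, ζ)]`, where `ζ` has law `P`. -/
def objective (P : Measure Ξ) (f : Vec d → Ξ → ℝ) (x : Vec d) : ℝ :=
  ∫ ζ, f x ζ ∂P

/-- The objective is well defined: `f(x, ζ)` is a random variable with finite expectation. -/
structure WellPosed (P : Measure Ξ) (f : Vec d → Ξ → ℝ) : Prop where
  measurable : ∀ x, Measurable (f x)
  integrable : ∀ x, Integrable (f x) P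

/-- Smoothness: `F` is `C²` and bounded below; each `f(·, ζ)` is `C²` with `Lf`-Lipschitz gradient
and `Mf`-Lipschitz Hessian. -/
structure Smoothness (P : Measure Ξ) (f : Vec d → Ξ → ℝ) (Lf Mf : ℝ) : Prop where
  contDiff_objective : ContDiff ℝ 2 (objective P f)
  bddBelow_objective : BddBelow (Set.range (objective P f))
  contDiff : ∀ ζ, ContDiff ℝ 2 (fun x => f x ζ)
  gradLipschitz : ∀ ζ, GradLipschitz (fun x => f x ζ) Lf
  hessLipschitz : ∀ ζ, HessLipschitz (fun x => f x ζ) Mf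

/-- Bounded variance of the stochastic gradients. -/
def BoundedVariance (P : Measure Ξ) (f : Vec d → Ξ → ℝ) : Prop :=
  ∃ β₁ β₂ : ℝ, 0 ≤ β₁ ∧ 0 ≤ β₂ ∧ ∀ x,
    Integrable (fun ζ => ‖gradient (fun y => f y ζ) x - gradient (objective P f) x‖ ^ 2) P ∧
    ∫ ζ, ‖gradient (fun y => f y ζ) x - gradient (objective P f) x‖ ^ 2 ∂P
      ≤ β₁ * ‖gradient (objective P f) x‖ ^ 2 + β₂

end Objective

/-- The five central finite-difference schemes: standard, Gaussian smoothing, sphere smoothing,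
randomized coordinate, randomized subspace. -/
inductive Scheme
  | cFD
  | cGS
  | cSS
  | cRC
  | cRS

/-- The canonical basis vector `e_j`. -/
def stdVec {d : ℕ} (j : Fin d) : Vec d := EuclideanSpace.single j 1

/-- The uniform probability measure on the unit sphere of `ℝ^d`, as a measure on `ℝ^d`. -/
def sphereUniform (d : ℕ) : Measure (Vec d) :=
  (((volume : Measure (Vec d)).toSphere Set.univ)⁻¹ •
    (volume : Measure (Vec d)).toSphere).map Subtype.val

/-- `τ` is the law of the tuple `T = (u_1, …, u_N)` of directions used by the scheme:
* cFD: `T = (e_1, …, e_d)`, deterministically;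
* cGS: `N` independent standard Gaussian vectors;
* cSS: `N` independent vectors uniform on the unit sphere;
* cRC: `N` distinct canonical vectors, chosen uniformly at random (without replacement);
* cRS: `N` random orthonormal vectors, isotropic in the sense that `𝔼[∑ u_j u_jᵀ] = (N/d) I`
  (in particular, uniformly distributed orthonormal `N`-frames, and uniformly chosen `N`-subsets
  of any random orthonormal basis). -/
def IsDirectionLaw (m : Scheme) {d N : ℕ} (τ : Measure (Fin N → Vec d)) : Prop :=
  match m with
  | .cFD => ∃ h : N = d, τ = Measure.dirac (fun j => stdVec (Fin.cast h j))
  | .cGS => τ = Measure.pi (fun _ => stdGaussian (Vec d))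
  | .cSS => τ = Measure.pi (fun _ => sphereUniform d)
  | .cRC => τ = (Fintype.card (Fin N ↪ Fin d) : ENNReal)⁻¹ •
      ∑ e : Fin N ↪ Fin d, Measure.dirac (fun j => stdVec (e j))
  | .cRS => (∀ᵐ u ∂τ, Orthonormal ℝ u) ∧
      ∀ v : Vec d, ∫ u, ∑ j, (inner ℝ (u j) v) ^ 2 ∂τ = (N : ℝ) / d * ‖v‖ ^ 2

/-- The scaling coefficient `γ` of the estimator in dimension `d` with `N` directions. -/
def scaling (m : Scheme) (d N : ℕ) : ℝ :=
  match m with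
  | .cFD => 1
  | .cGS => 1 / N
  | .cSS => d / N
  | .cRC => d / N
  | .cRS => d / N

/-- `Ω₁ = 1 / (4 (1 + θ²) L)`. -/
def Omega₁ (θ L : ℝ) : ℝ := 1 / (4 * (1 + θ ^ 2) * L)

/-- `Ω₂ = d M² ν⁴ / 48`. -/
def Omega₂ (d : ℕ) (M ν : ℝ) : ℝ := d * M ^ 2 * ν ^ 4 / 48

/-- The step size bound `ᾱ`. -/
def alphaBar (m : Scheme) (d N : ℕ) (θ L : ℝ) : ℝ :=
  match m with
  | .cFD => Omega₁ θ L
  | .cGS => N / (N + 4.5 * d) * Omega₁ θ L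
  | .cSS => N / (N + 4.5 * d) * Omega₁ θ L
  | .cRC => N / d * Omega₁ θ L
  | .cRS => N / d * Omega₁ θ L

/-- The error term `χ`. -/
def chi (m : Scheme) (d N : ℕ) (M ν : ℝ) : ℝ :=
  match m with
  | .cFD => Omega₂ d M ν
  | .cGS => (72 * N * d + 216 * d ^ 2 + (d + 2) * (d + 4) * (d + 6)) / (2 * (N + 4.5 * d))
      * Omega₂ d M ν
  | .cSS => (72 * N + 216 * d + d ^ 2) / (2 * d * (N + 4.5 * d)) * Omega₂ d M ν
  | .cRC => Omega₂ d M ν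
  | .cRS => Omega₂ d M ν

/-- The central finite-difference gradient estimator of `φ` at `x` along `u_1, …, u_N`:
`γ ∑_j (φ(x + ν u_j) - φ(x - ν u_j)) / (2 ν) • u_j`. -/
def gradEst {d N : ℕ} (φ : Vec d → ℝ) (ν γ : ℝ) (u : Fin N → Vec d) (x : Vec d) : Vec d :=
  γ • ∑ j, ((φ (x + ν • u j) - φ (x - ν • u j)) / (2 * ν)) • u j

/-- A finite sample `(ζ_1, …, ζ_n)` of random size `n`. -/
abbrev Sample (Ξ : Type*) : Type _ := Σ n : ℕ, (Fin n → Ξ)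

/-- The subsampled function `F_S(x) = (1/|S|) ∑_{ζ ∈ S} f(x, ζ)`. -/
def subsampled {d : ℕ} {Ξ : Type*} (f : Vec d → Ξ → ℝ) (s : Sample Ξ) (x : Vec d) : ℝ :=
  (1 / (s.1 : ℝ)) * ∑ i, f x (s.2 i)

section Iteration

variable {d : ℕ} {Ω Ξ : Type*} [MeasurableSpace Ω] [MeasurableSpace Ξ] {N : ℕ → ℕ}

/-- The iterates `x_{k+1} = x_k - α_k g_{S_k,T_k}(x_k)`, started at the given point `x₀`. -/
def iter (m : Scheme) (f : Vec d → Ξ → ℝ) (ν : ℝ) (α : ℕ → ℝ)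
    (T : (k : ℕ) → Ω → Fin (N k) → Vec d) (S : ℕ → Ω → Sample Ξ) (x₀ : Vec d) :
    ℕ → Ω → Vec d
  | 0, _ => x₀
  | k + 1, ω => iter m f ν α T S x₀ k ω - α k •
      gradEst (subsampled f (S k ω)) ν (scaling m d (N k)) (T k ω) (iter m f ν α T S x₀ k ω)

/-- `ℱ_k`: the σ-algebra generated by the directions and samples of the iterations before `k`. -/
abbrev past (T : (k : ℕ) → Ω → Fin (N k) → Vec d) (S : ℕ → Ω → Sample Ξ) (k : ℕ) :
    MeasurableSpace Ω :=
  ⨆ j : Fin k, (MeasurableSpace.comap (T j) inferInstance ⊔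
    MeasurableSpace.comap (S j) inferInstance)

/-- `ℱ_{k+1/2}`: the σ-algebra generated by `ℱ_k` and the directions of iteration `k`. -/
abbrev pastHalf (T : (k : ℕ) → Ω → Fin (N k) → Vec d) (S : ℕ → Ω → Sample Ξ) (k : ℕ) :
    MeasurableSpace Ω :=
  past T S k ⊔ MeasurableSpace.comap (T k) inferInstance

/-- The sampling scheme: at iteration `k`, the directions `T_k` are drawn independently of the past
from the law of the method; the sample size `|S_k| ≥ 1` is determined by the past; and,
conditionally on the past and on `T_k`, the elements of `S_k` are `|S_k|` independent draws
from `P`. -/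
structure Sampling (μ : Measure Ω) (P : Measure Ξ) (m : Scheme)
    (T : (k : ℕ) → Ω → Fin (N k) → Vec d) (S : ℕ → Ω → Sample Ξ) : Prop where
  measurable_T : ∀ k, Measurable (T k)
  measurable_S : ∀ k, Measurable (S k)
  law_T : ∀ k, IsDirectionLaw m (μ.map (T k))
  indep_T : ∀ k, Indep (MeasurableSpace.comap (T k) inferInstance) (past T S k) μ
  size_pos : ∀ k ω, 1 ≤ (S k ω).1
  size_past : ∀ k, Measurable[past T S k] (fun ω => (S k ω).1)
  iid_S : ∀ k n, ∀ B : Set Ω, MeasurableSet[pastHalf T S k] B →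
    ∀ A : Set (Fin n → Ξ), MeasurableSet A →
      μ (B ∩ {ω | ∃ z ∈ A, S k ω = ⟨n, z⟩})
        = μ (B ∩ {ω | (S k ω).1 = n}) * Measure.pi (fun _ : Fin n => P) A

/-- `g_{T_k}(x_k) = 𝔼_{S_k}[g_{S_k,T_k}(x_k)]`, where `𝔼_{S_k} = 𝔼[· | ℱ_{k+1/2}]`. -/
def gT (μ : Measure Ω) (m : Scheme) (f : Vec d → Ξ → ℝ) (ν : ℝ) (α : ℕ → ℝ)
    (T : (k : ℕ) → Ω → Fin (N k) → Vec d) (S : ℕ → Ω → Sample Ξ) (x₀ : Vec d) (k : ℕ) :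
    Ω → Vec d :=
  μ[fun ω => gradEst (subsampled f (S k ω)) ν (scaling m d (N k)) (T k ω)
      (iter m f ν α T S x₀ k ω) | pastHalf T S k]

/-- The theoretical norm condition at iteration `k`:
`𝔼_{T_k}[𝔼_ζ[‖g_{ζ,T_k}(x_k) - g_{T_k}(x_k)‖²]] / |S_k| ≤ θ² 𝔼_{T_k}[‖g_{T_k}(x_k)‖²]` a.s.,
where `𝔼_{T_k} = 𝔼[· | ℱ_k]`. -/
def NormCondition (μ : Measure Ω) (P : Measure Ξ) (m : Scheme) (f : Vec d → Ξ → ℝ) (ν : ℝ)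
    (α : ℕ → ℝ) (T : (k : ℕ) → Ω → Fin (N k) → Vec d) (S : ℕ → Ω → Sample Ξ) (x₀ : Vec d)
    (θ : ℝ) (k : ℕ) : Prop :=
  ∀ᵐ ω ∂μ,
    (μ[fun ω' => ∫ ζ, ‖gradEst (fun y => f y ζ) ν (scaling m d (N k)) (T k ω')
          (iter m f ν α T S x₀ k ω') - gT μ m f ν α T S x₀ k ω'‖ ^ 2 ∂P | past T S k]) ω
        / ((S k ω).1 : ℝ)
      ≤ θ ^ 2 * (μ[fun ω' => ‖gT μ m f ν α T S x₀ k ω'‖ ^ 2 | past T S k]) ω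

end Iteration

end

end CFD

/-
The second-order Taylor terms at `x ± νu` cancel in the central difference quotient, which differs
from `⟪∇F(x), u⟫` by an error of size at most `M ν² ‖u‖³ / 6`. For a rotation-invariant law of `u`
the moments of the linear part reduce to those of `‖u‖`, and reflecting `u` in the hyperplane
orthogonal to `v` bounds the bias in the direction `v` by the oscillation of the error between
mirror images. For orthonormal directions Bessel's inequality bounds the estimator pathwise. Either
way the expected change of the quadratic upper model `-⟪∇F, g⟫ + (c/8) ‖g‖²` is at most
`-‖∇F‖² / 4 + χ` when the samples are averaged out. Sampling adds the variance of `g`, which the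
norm condition absorbs by inflating the coefficient of `‖g‖²` by `1 + θ²`: hence the factor
`1 / (1 + θ²)` in the step size bound. Conditioning first on `ℱ_{k+1/2}` and then on `ℱ_k`
separates the two effects.
-/

namespace CFD

section Taylor

variable {E G : Type*} [NormedAddCommGroup E] [NormedSpace ℝ E] [NormedAddCommGroup G]
  [NormedSpace ℝ G]

lemma norm_apply_one_le_of_norm_deriv_le_pow {p p' : ℝ → G} (n : ℕ) (c : ℝ) (h0 : p 0 = 0)
    (hp : ∀ t, HasDerivAt p (p' t) t) (hb : ∀ t, 0 ≤ t → ‖p' t‖ ≤ c * t ^ n) :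
    ‖p 1‖ ≤ c / (n + 1) := by
  have hB (t : ℝ) : HasDerivAt (fun t : ℝ ↦ c / (n + 1) * t ^ (n + 1)) (c * t ^ n) t := by
    refine ((hasDerivAt_pow (n + 1) t).const_mul (c / (n + 1))).congr_deriv ?_
    push_cast
    field_simp
  simpa using image_norm_le_of_norm_deriv_right_le_deriv_boundary (a := 0) (b := 1)
    (fun t _ ↦ (hp t).continuousAt.continuousWithinAt) (fun t _ ↦ (hp t).hasDerivWithinAt)
    (by simp [h0]) hB (fun t ht ↦ hb t ht.1) (x := 1) (by simp)

lemma norm_sub_sub_apply_le_of_lipschitz_fderiv {g : E → G} {g' : E → E →L[ℝ] G} {L : ℝ}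
    (hg : ∀ x, HasFDerivAt g (g' x) x) (hL : ∀ x y, ‖g' x - g' y‖ ≤ L * ‖x - y‖) (x v : E) :
    ‖g (x + v) - g x - g' x v‖ ≤ L / 2 * ‖v‖ ^ 2 := by
  have hline (t : ℝ) : HasDerivAt (fun t : ℝ ↦ x + t • v) v t := by
    simpa using ((hasDerivAt_id t).smul_const v).const_add x
  have hderiv (t : ℝ) : HasDerivAt (fun t : ℝ ↦ g (x + t • v) - g x - t • g' x v)
      (g' (x + t • v) v - g' x v) t := by
    have hlin : HasDerivAt (fun t : ℝ ↦ t • g' x v) (g' x v) t := by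
      simpa using (hasDerivAt_id t).smul_const (g' x v)
    exact (((hg _).comp_hasDerivAt t (hline t)).sub_const (g x)).fun_sub hlin
  have hbound (t : ℝ) (ht : 0 ≤ t) : ‖g' (x + t • v) v - g' x v‖ ≤ L * ‖v‖ ^ 2 * t ^ 1 := by
    calc ‖g' (x + t • v) v - g' x v‖ ≤ ‖g' (x + t • v) - g' x‖ * ‖v‖ :=
          (g' (x + t • v) - g' x).le_opNorm v
      _ ≤ L * ‖x + t • v - x‖ * ‖v‖ := by gcongr; exact hL _ _
      _ = L * ‖v‖ ^ 2 * t ^ 1 := by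
          rw [add_sub_cancel_left, norm_smul, Real.norm_of_nonneg ht]; ring
  have key := norm_apply_one_le_of_norm_deriv_le_pow 1 (L * ‖v‖ ^ 2) (by simp) hderiv hbound
  simp only [one_smul] at key
  exact key.trans_eq (by push_cast; ring)

end Taylor

section Calculus

variable {d : ℕ} {φ : Vec d → ℝ} {L M ν : ℝ}

lemma hasGradientAt_of_contDiff (hφ : ContDiff ℝ 2 φ) (x : Vec d) :
    HasGradientAt φ (gradient φ x) x :=
  (hφ.differentiable (by norm_num) x).hasGradientAt

lemma contDiff_gradient (hφ : ContDiff ℝ 2 φ) : ContDiff ℝ 1 (gradient φ) :=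
  (InnerProductSpace.toDual ℝ (Vec d)).symm.contDiff.comp
    (hφ.fderiv_right (m := 1) (by norm_num))

lemma hasFDerivAt_gradient (hφ : ContDiff ℝ 2 φ) (x : Vec d) :
    HasFDerivAt (gradient φ) (hessian φ x) x :=
  ((contDiff_gradient hφ).differentiable (by norm_num) x).hasFDerivAt

lemma GradLipschitz.nonneg (hd : 1 ≤ d) (h : GradLipschitz φ L) : 0 ≤ L := by
  simpa [stdVec] using (norm_nonneg _).trans (h (stdVec ⟨0, hd⟩) 0)

lemma HessLipschitz.nonneg (hd : 1 ≤ d) (h : HessLipschitz φ M) : 0 ≤ M := by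
  simpa [stdVec] using (norm_nonneg _).trans (h (stdVec ⟨0, hd⟩) 0)

lemma GradLipschitz.norm_gradient_le (h : GradLipschitz φ L) (x y : Vec d) :
    ‖gradient φ y‖ ≤ ‖gradient φ x‖ + L * ‖y - x‖ := by
  linarith [h y x, norm_le_norm_add_norm_sub' (gradient φ y) (gradient φ x)]

lemma GradLipschitz.abs_sub_sub_inner_le (hφ : ContDiff ℝ 2 φ) (h : GradLipschitz φ L)
    (x v : Vec d) : |φ (x + v) - φ x - inner ℝ (gradient φ x) v| ≤ L / 2 * ‖v‖ ^ 2 := by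
  refine norm_sub_sub_apply_le_of_lipschitz_fderiv
    (fun x ↦ (hasGradientAt_of_contDiff hφ x).hasFDerivAt) (fun x y ↦ ?_) x v
  rw [← map_sub, LinearIsometryEquiv.norm_map]
  exact h x y

lemma HessLipschitz.norm_gradient_symm_sub_le (hφ : ContDiff ℝ 2 φ) (h : HessLipschitz φ M)
    (x z : Vec d) :
    ‖gradient φ (x + z) + gradient φ (x - z) - (2 : ℝ) • gradient φ x‖ ≤ M * ‖z‖ ^ 2 := by
  have taylor := norm_sub_sub_apply_le_of_lipschitz_fderiv (hasFDerivAt_gradient hφ) h x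
  have hsplit : gradient φ (x + z) + gradient φ (x - z) - (2 : ℝ) • gradient φ x
      = (gradient φ (x + z) - gradient φ x - hessian φ x z)
        + (gradient φ (x + -z) - gradient φ x - hessian φ x (-z)) := by
    rw [map_neg, two_smul, sub_eq_add_neg x z]
    abel
  rw [hsplit]
  refine (norm_add_le_of_le (taylor z) (taylor (-z))).trans_eq ?_
  rw [norm_neg]
  ring

lemma GradLipschitz.abs_centralDiff_le (hφ : ContDiff ℝ 2 φ) (hL : 0 ≤ L)
    (h : GradLipschitz φ L) (hν : 0 < ν) (x u : Vec d) :
    |(φ (x + ν • u) - φ (x - ν • u)) / (2 * ν)| ≤ (‖gradient φ x‖ + L * ν * ‖u‖) * ‖u‖ := by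
  have hnorm : ‖ν • u‖ = ν * ‖u‖ := by rw [norm_smul, Real.norm_of_nonneg hν.le]
  have hmvt := (convex_closedBall x (ν * ‖u‖)).norm_image_sub_le_of_norm_hasFDerivWithin_le
    (C := ‖gradient φ x‖ + L * ν * ‖u‖) (x := x - ν • u) (y := x + ν • u)
    (fun y _ ↦ (hasGradientAt_of_contDiff hφ y).hasFDerivAt.hasFDerivWithinAt)
    (fun y hy ↦ by
      have hy : ‖y - x‖ ≤ ν * ‖u‖ := by simpa [dist_eq_norm] using hy
      rw [LinearIsometryEquiv.norm_map, mul_assoc]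
      exact (h.norm_gradient_le x y).trans (by gcongr))
    (by simp [hnorm]) (by simp [hnorm])
  rw [add_sub_sub_cancel, ← two_smul ℝ, norm_smul, hnorm, Real.norm_eq_abs] at hmvt
  rw [abs_div, abs_of_pos (by positivity : 0 < 2 * ν), div_le_iff₀ (by positivity)]
  exact hmvt.trans_eq (by norm_num; ring)

/-- The error `(φ(x + νu) - φ(x - νu)) / (2ν) - ⟪∇φ(x), u⟫` of the central difference quotient
in direction `u`: the source of the bias of the estimator. -/
noncomputable def diffErr (φ : Vec d → ℝ) (ν : ℝ) (x u : Vec d) : ℝ :=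
  (φ (x + ν • u) - φ (x - ν • u)) / (2 * ν) - inner ℝ (gradient φ x) u

lemma continuous_diffErr (hφ : Continuous φ) (ν : ℝ) (x : Vec d) :
    Continuous (diffErr φ ν x) := by
  unfold diffErr
  fun_prop

lemma hasGradientAt_diffErr (hφ : ContDiff ℝ 2 φ) (hν : ν ≠ 0) (x u : Vec d) :
    HasGradientAt (diffErr φ ν x) ((1 / 2 : ℝ) • (gradient φ (x + ν • u) + gradient φ (x - ν • u)
      - (2 : ℝ) • gradient φ x)) u := by
  have hplus : HasFDerivAt (fun u ↦ x + ν • u) (ν • ContinuousLinearMap.id ℝ (Vec d)) u :=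
    ((hasFDerivAt_id u).const_smul ν).const_add x
  have hminus : HasFDerivAt (fun u ↦ x - ν • u) (-(ν • ContinuousLinearMap.id ℝ (Vec d))) u :=
    ((hasFDerivAt_id u).const_smul ν).const_sub x
  have hquot := (((hasGradientAt_of_contDiff hφ (x + ν • u)).hasFDerivAt.comp u hplus).sub
    ((hasGradientAt_of_contDiff hφ (x - ν • u)).hasFDerivAt.comp u hminus)).const_mul (2 * ν)⁻¹
  have herr := hquot.sub (InnerProductSpace.toDual ℝ (Vec d) (gradient φ x)).hasFDerivAt
  rw [hasGradientAt_iff_hasFDerivAt]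
  refine (herr.congr_fderiv ?_).congr_of_eventuallyEq (.of_forall fun y ↦ ?_)
  · ext w
    simp only [mul_inv_rev, toDual_gradient, ContinuousLinearMap.comp_smulₛₗ, Real.ringHom_apply,
      ContinuousLinearMap.comp_id, ContinuousLinearMap.comp_neg, sub_neg_eq_add, smul_add,
      sub_apply, add_apply, smul_apply, smul_eq_mul, one_div, map_smul, map_sub, map_add]
    field_simp
  · simp [diffErr, div_eq_inv_mul]

lemma HessLipschitz.norm_gradient_diffErr_le (hφ : ContDiff ℝ 2 φ) (h : HessLipschitz φ M)
    (hν : ν ≠ 0) (x u : Vec d) :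
    ‖gradient (diffErr φ ν x) u‖ ≤ M * ν ^ 2 / 2 * ‖u‖ ^ 2 := by
  have hsymm := h.norm_gradient_symm_sub_le hφ x (ν • u)
  rw [norm_smul, mul_pow, Real.norm_eq_abs, sq_abs] at hsymm
  rw [(hasGradientAt_diffErr hφ hν x u).gradient, norm_smul, Real.norm_of_nonneg (by norm_num)]
  linarith

lemma HessLipschitz.abs_diffErr_le (hφ : ContDiff ℝ 2 φ) (h : HessLipschitz φ M) (hν : ν ≠ 0)
    (x u : Vec d) : |diffErr φ ν x u| ≤ M * ν ^ 2 / 6 * ‖u‖ ^ 3 := by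
  have hderiv (t : ℝ) : HasDerivAt (fun t : ℝ ↦ diffErr φ ν x (t • u))
      (inner ℝ (gradient (diffErr φ ν x) (t • u)) u) t := by
    have hline : HasDerivAt (fun t : ℝ ↦ t • u) u t := by
      simpa using (hasDerivAt_id t).smul_const u
    have hgrad := hasGradientAt_diffErr hφ hν x (t • u)
    rw [hgrad.gradient]
    exact hgrad.hasFDerivAt.comp_hasDerivAt t hline
  have hbound (t : ℝ) (ht : 0 ≤ t) : ‖inner ℝ (gradient (diffErr φ ν x) (t • u)) u‖
      ≤ M * ν ^ 2 / 2 * ‖u‖ ^ 3 * t ^ 2 := by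
    calc ‖inner ℝ (gradient (diffErr φ ν x) (t • u)) u‖
        ≤ ‖gradient (diffErr φ ν x) (t • u)‖ * ‖u‖ := norm_inner_le_norm _ _
      _ ≤ M * ν ^ 2 / 2 * ‖t • u‖ ^ 2 * ‖u‖ := by
          gcongr; exact h.norm_gradient_diffErr_le hφ hν x (t • u)
      _ = M * ν ^ 2 / 2 * ‖u‖ ^ 3 * t ^ 2 := by
          rw [norm_smul, Real.norm_of_nonneg ht]; ring
  have key := norm_apply_one_le_of_norm_deriv_le_pow 2 (M * ν ^ 2 / 2 * ‖u‖ ^ 3)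
    (by simp [diffErr]) hderiv hbound
  rw [one_smul, Real.norm_eq_abs] at key
  exact key.trans_eq (by push_cast; ring)

lemma HessLipschitz.abs_diffErr_sub_le (hφ : ContDiff ℝ 2 φ) (hM : 0 ≤ M)
    (h : HessLipschitz φ M) (hν : ν ≠ 0) (x : Vec d) {u u' : Vec d} (hu : ‖u'‖ ≤ ‖u‖) :
    |diffErr φ ν x u - diffErr φ ν x u'| ≤ M * ν ^ 2 / 2 * ‖u‖ ^ 2 * ‖u - u'‖ := by
  refine (convex_closedBall (0 : Vec d) ‖u‖).norm_image_sub_le_of_norm_hasFDerivWithin_le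
    (fun y _ ↦ (hasGradientAt_diffErr hφ hν x y).hasFDerivAt.hasFDerivWithinAt)
    (fun y hy ↦ ?_) (by simpa using hu) (by simp)
  rw [LinearIsometryEquiv.norm_map, ← (hasGradientAt_diffErr hφ hν x y).gradient]
  have hy : ‖y‖ ≤ ‖u‖ := by simpa using hy
  exact (h.norm_gradient_diffErr_le hφ hν x y).trans (by gcongr)

end Calculus

section Objective

lemma norm_le_of_hasFDerivAt_integral {E G Ξ : Type*} [NormedAddCommGroup E] [NormedSpace ℝ E]
    [NormedAddCommGroup G] [NormedSpace ℝ G] [MeasurableSpace Ξ] {P : Measure Ξ}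
    [IsProbabilityMeasure P] {g : E → Ξ → G} {g' : E →L[ℝ] G} {x : E} {C : ℝ} (hC : 0 ≤ C)
    (hint : ∀ w, Integrable (g w) P) (hlip : ∀ ζ w, ‖g w ζ - g x ζ‖ ≤ C * ‖w - x‖)
    (hg : HasFDerivAt (fun w ↦ ∫ ζ, g w ζ ∂P) g' x) : ‖g'‖ ≤ C := by
  refine hg.le_of_lip' hC (.of_forall fun w ↦ ?_)
  rw [← integral_sub (hint w) (hint x)]
  simpa using norm_integral_le_of_norm_le_const (μ := P) (.of_forall fun ζ ↦ hlip ζ w)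

variable {d : ℕ} {Ξ : Type*} [MeasurableSpace Ξ] {P : Measure Ξ} {f : Vec d → Ξ → ℝ}
  {Lf Mf : ℝ}

/-- The regularity of the loss that a single step relies on: every `f(·, ζ)` and the objective are
`C²`, the `f(·, ζ)` have `Lf`-Lipschitz gradients and `Mf`-Lipschitz Hessians, and the stochastic
gradient at the origin has finite variance. -/
structure RegularLoss (P : Measure Ξ) (f : Vec d → Ξ → ℝ) (Lf Mf : ℝ) : Prop
    extends WellPosed P f where
  contDiff_objective : ContDiff ℝ 2 (objective P f)
  contDiff : ∀ ζ, ContDiff ℝ 2 (fun x ↦ f x ζ)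
  gradLipschitz : ∀ ζ, GradLipschitz (fun x ↦ f x ζ) Lf
  hessLipschitz : ∀ ζ, HessLipschitz (fun x ↦ f x ζ) Mf
  integrable_norm_gradient_sub_sq :
    Integrable (fun ζ ↦ ‖gradient (fun x ↦ f x ζ) 0 - gradient (objective P f) 0‖ ^ 2) P

lemma RegularLoss.continuous (hf : RegularLoss P f Lf Mf) (ζ : Ξ) : Continuous fun x ↦ f x ζ :=
  (hf.contDiff ζ).continuous

lemma RegularLoss.continuous_objective (hf : RegularLoss P f Lf Mf) :
    Continuous (objective P f) :=
  hf.contDiff_objective.continuous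

variable [IsProbabilityMeasure P]

lemma RegularLoss.gradLipschitz_nonneg (hd : 1 ≤ d) (hf : RegularLoss P f Lf Mf) : 0 ≤ Lf := by
  obtain ⟨ζ⟩ := nonempty_of_isProbabilityMeasure P
  exact (hf.gradLipschitz ζ).nonneg hd

lemma RegularLoss.hessLipschitz_nonneg (hd : 1 ≤ d) (hf : RegularLoss P f Lf Mf) : 0 ≤ Mf := by
  obtain ⟨ζ⟩ := nonempty_of_isProbabilityMeasure P
  exact (hf.hessLipschitz ζ).nonneg hd

lemma hasFDerivAt_sub_shift {φ : Vec d → ℝ} (hφ : ContDiff ℝ 2 φ) (x y w : Vec d) :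
    HasFDerivAt (fun w ↦ φ (x + w) - φ (y + w))
      (InnerProductSpace.toDual ℝ (Vec d) (gradient φ (x + w) - gradient φ (y + w))) w := by
  rw [map_sub]
  exact ((hasFDerivAt_comp_add_left x).2 (hasGradientAt_of_contDiff hφ _).hasFDerivAt).sub
    ((hasFDerivAt_comp_add_left y).2 (hasGradientAt_of_contDiff hφ _).hasFDerivAt)

lemma RegularLoss.gradLipschitz_objective (hd : 1 ≤ d) (hf : RegularLoss P f Lf Mf) :
    GradLipschitz (objective P f) Lf := by
  intro x y
  have hlip (ζ : Ξ) (w : Vec d) : ‖f (x + w) ζ - f (y + w) ζ - (f (x + 0) ζ - f (y + 0) ζ)‖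
      ≤ Lf * ‖x - y‖ * ‖w - 0‖ := by
    refine convex_univ.norm_image_sub_le_of_norm_hasFDerivWithin_le
      (fun w _ ↦ (hasFDerivAt_sub_shift (hf.contDiff ζ) x y w).hasFDerivWithinAt)
      (fun w _ ↦ ?_) (Set.mem_univ 0) (Set.mem_univ w)
    rw [LinearIsometryEquiv.norm_map]
    simpa using hf.gradLipschitz ζ (x + w) (y + w)
  have hderiv : HasFDerivAt (fun w ↦ ∫ ζ, (f (x + w) ζ - f (y + w) ζ) ∂P) _ 0 :=
    (hasFDerivAt_sub_shift hf.contDiff_objective x y 0).congr_of_eventuallyEq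
      (.of_forall fun w ↦ integral_sub (hf.integrable (x + w)) (hf.integrable (y + w)))
  have hnorm := norm_le_of_hasFDerivAt_integral
    (mul_nonneg (hf.gradLipschitz_nonneg hd) (norm_nonneg (x - y)))
    (fun w ↦ (hf.integrable (x + w)).sub (hf.integrable (y + w))) hlip hderiv
  simpa only [LinearIsometryEquiv.norm_map, add_zero] using hnorm

lemma HessLipschitz.norm_gradient_mixed_sub_le {φ : Vec d → ℝ} {M : ℝ} (hφ : ContDiff ℝ 2 φ)
    (h : HessLipschitz φ M) (x y z : Vec d) :
    ‖gradient φ (x + z) - gradient φ (y + z) - (gradient φ x - gradient φ y)‖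
      ≤ M * ‖x - y‖ * ‖z‖ := by
  have hderiv (w : Vec d) : HasFDerivAt (fun w ↦ gradient φ (x + w) - gradient φ (y + w))
      (hessian φ (x + w) - hessian φ (y + w)) w :=
    ((hasFDerivAt_comp_add_left x).2 (hasFDerivAt_gradient hφ _)).sub
      ((hasFDerivAt_comp_add_left y).2 (hasFDerivAt_gradient hφ _))
  simpa using convex_univ.norm_image_sub_le_of_norm_hasFDerivWithin_le
    (fun w _ ↦ (hderiv w).hasFDerivWithinAt)
    (fun w _ ↦ by simpa using h (x + w) (y + w)) (Set.mem_univ 0) (Set.mem_univ z)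

lemma RegularLoss.norm_gradient_objective_mixed_sub_le (hd : 1 ≤ d)
    (hf : RegularLoss P f Lf Mf) (x y z : Vec d) :
    ‖gradient (objective P f) (x + z) - gradient (objective P f) (y + z)
      - (gradient (objective P f) x - gradient (objective P f) y)‖ ≤ Mf * ‖x - y‖ * ‖z‖ := by
  have hMf : 0 ≤ Mf := hf.hessLipschitz_nonneg hd
  have hpoint {φ : Vec d → ℝ} (hφ : ContDiff ℝ 2 φ) (w : Vec d) :=
    (hasFDerivAt_sub_shift hφ (x + z) (y + z) w).fun_sub (hasFDerivAt_sub_shift hφ x y w)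
  have hlip (ζ : Ξ) (w : Vec d) :
      ‖f (x + z + w) ζ - f (y + z + w) ζ - (f (x + w) ζ - f (y + w) ζ)
        - (f (x + z + 0) ζ - f (y + z + 0) ζ - (f (x + 0) ζ - f (y + 0) ζ))‖
        ≤ Mf * ‖x - y‖ * ‖z‖ * ‖w - 0‖ := by
    refine convex_univ.norm_image_sub_le_of_norm_hasFDerivWithin_le
      (fun w _ ↦ (hpoint (hf.contDiff ζ) w).hasFDerivWithinAt)
      (fun w _ ↦ ?_) (Set.mem_univ 0) (Set.mem_univ w)
    rw [← map_sub, LinearIsometryEquiv.norm_map, add_right_comm x, add_right_comm y]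
    simpa using (hf.hessLipschitz ζ).norm_gradient_mixed_sub_le (hf.contDiff ζ) (x + w) (y + w) z
  have hsub (a b : Vec d) : Integrable (fun ζ ↦ f a ζ - f b ζ) P :=
    (hf.integrable a).sub (hf.integrable b)
  have hderiv : HasFDerivAt (fun w ↦ ∫ ζ, (f (x + z + w) ζ - f (y + z + w) ζ
      - (f (x + w) ζ - f (y + w) ζ)) ∂P) _ 0 :=
    (hpoint hf.contDiff_objective 0).congr_of_eventuallyEq (.of_forall fun w ↦ by
      simp only [objective, integral_sub, hsub, hf.integrable])
  have hnorm := norm_le_of_hasFDerivAt_integral (by positivity)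
    (fun w ↦ (hsub _ _).sub (hsub _ _)) hlip hderiv
  simpa only [← map_sub, LinearIsometryEquiv.norm_map, add_zero] using hnorm

lemma RegularLoss.hessLipschitz_objective (hd : 1 ≤ d) (hf : RegularLoss P f Lf Mf) :
    HessLipschitz (objective P f) Mf := by
  intro x y
  have hMf : 0 ≤ Mf := hf.hessLipschitz_nonneg hd
  have hderiv := ((hasFDerivAt_comp_add_left (x := 0) x).2
    (hasFDerivAt_gradient hf.contDiff_objective _)).sub
    ((hasFDerivAt_comp_add_left (x := 0) y).2 (hasFDerivAt_gradient hf.contDiff_objective _))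
  rw [add_zero, add_zero] at hderiv
  refine hderiv.le_of_lip' (by positivity) (.of_forall fun z ↦ ?_)
  simpa using hf.norm_gradient_objective_mixed_sub_le hd x y z

end Objective

section Independent

variable {ι X E : Type*} [Fintype ι] [MeasurableSpace X] {ρ : Measure X}

lemma memLp_two_mul_of_indepFun {f g : X → ℝ} (h : IndepFun f g ρ) (hf : MemLp f 2 ρ)
    (hg : MemLp g 2 ρ) : MemLp (fun x ↦ f x * g x) 2 ρ := by
  refine (memLp_two_iff_integrable_sq (hf.1.mul hg.1)).2 ?_
  simp only [Pi.mul_apply, mul_pow]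
  exact (h.comp (φ := (· ^ 2)) (ψ := (· ^ 2)) (by fun_prop) (by fun_prop)).integrable_mul
    hf.integrable_sq hg.integrable_sq

lemma integrable_inner_of_memLp_two [NormedAddCommGroup E] [InnerProductSpace ℝ E]
    {f g : X → E} (hf : MemLp f 2 ρ) (hg : MemLp g 2 ρ) :
    Integrable (fun x ↦ inner ℝ (f x) (g x)) ρ :=
  (hf.norm.integrable_mul hg.norm).mono' (hf.1.inner hg.1)
    (.of_forall fun _ ↦ norm_inner_le_norm _ _)

variable [IsProbabilityMeasure ρ]

lemma memLp_comp_eval_pi [NormedAddCommGroup E] {w : X → E} (hw : MemLp w 2 ρ) (j : ι) :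
    MemLp (fun u : ι → X ↦ w (u j)) 2 (Measure.pi fun _ ↦ ρ) :=
  hw.comp_measurePreserving (measurePreserving_eval (fun _ ↦ ρ) j)

lemma integral_sum_comp_eval_pi [NormedAddCommGroup E] [NormedSpace ℝ E] {w : X → E}
    (hw : Integrable w ρ) :
    ∫ u : ι → X, ∑ j, w (u j) ∂(Measure.pi fun _ ↦ ρ) = Fintype.card ι • ∫ x, w x ∂ρ := by
  rw [integral_finsetSum _ fun j _ ↦ integrable_comp_eval (μ := fun _ ↦ ρ) hw]
  simp only [integral_comp_eval (μ := fun _ : ι ↦ ρ) hw.1, Finset.sum_const, Finset.card_univ]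

variable [NormedAddCommGroup E] [InnerProductSpace ℝ E] [CompleteSpace E] [MeasurableSpace E]
  [BorelSpace E]

lemma integral_inner_comp_eval_pi [DecidableEq ι] {w : X → E} (hw : MemLp w 2 ρ) (i j : ι) :
    ∫ u : ι → X, inner ℝ (w (u i)) (w (u j)) ∂(Measure.pi fun _ ↦ ρ)
      = if i = j then ∫ x, ‖w x‖ ^ 2 ∂ρ else ‖∫ x, w x ∂ρ‖ ^ 2 := by
  split_ifs with h
  · subst h
    simp only [real_inner_self_eq_norm_sq]
    exact integral_comp_eval (μ := fun _ ↦ ρ) (i := i) (hw.1.norm.pow 2)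
  · have hind : iIndepFun (fun j (u : ι → X) ↦ w (u j)) (Measure.pi fun _ ↦ ρ) :=
      iIndepFun_pi fun _ ↦ hw.1.aemeasurable
    have hint (j : ι) := (memLp_comp_eval_pi hw j).integrable one_le_two
    have hmean (j : ι) := integral_comp_eval (μ := fun _ ↦ ρ) (i := j) hw.1
    simpa [hmean, innerSL_apply_apply ℝ] using
      (hind.indepFun h).integral_bilin (hint i) (hint j) (innerSL ℝ)

lemma integral_norm_sum_sq_pi {w : X → E} (hw : MemLp w 2 ρ) :
    ∫ u : ι → X, ‖∑ j, w (u j)‖ ^ 2 ∂(Measure.pi fun _ ↦ ρ)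
      = Fintype.card ι * ∫ x, ‖w x‖ ^ 2 ∂ρ
        + Fintype.card ι * (Fintype.card ι - 1) * ‖∫ x, w x ∂ρ‖ ^ 2 := by
  classical
  have hint (i j : ι) := integrable_inner_of_memLp_two (memLp_comp_eval_pi hw i)
    (memLp_comp_eval_pi hw j)
  have hexp (u : ι → X) : ‖∑ j, w (u j)‖ ^ 2 = ∑ i, ∑ j, inner ℝ (w (u i)) (w (u j)) := by
    simp only [← real_inner_self_eq_norm_sq, sum_inner, inner_sum, real_inner_comm]
  simp only [hexp]
  rw [integral_finsetSum _ fun i _ ↦ integrable_finsetSum _ fun j _ ↦ hint i j]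
  simp only [integral_finsetSum _ fun j _ ↦ hint _ j, integral_inner_comp_eval_pi hw]
  have hrow (i : ι) (a b : ℝ) : (∑ j, if i = j then a else b) = a + (Fintype.card ι - 1) * b := by
    have (j : ι) : (if i = j then a else b) = b + if i = j then a - b else 0 := by
      split_ifs <;> ring
    simp only [this, Finset.sum_add_distrib, Finset.sum_ite_eq, Finset.mem_univ, if_true,
      Finset.sum_const, Finset.card_univ, nsmul_eq_mul]
    ring
  simp only [hrow, Finset.sum_const, Finset.card_univ, nsmul_eq_mul]
  ring

end Independent

section Gaussian

open Module

variable {E : Type*} [NormedAddCommGroup E] [InnerProductSpace ℝ E] [FiniteDimensional ℝ E]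
  [MeasurableSpace E] [BorelSpace E]

lemma integrable_norm_pow_stdGaussian (n : ℕ) :
    Integrable (fun u : E ↦ ‖u‖ ^ n) (stdGaussian E) :=
  (IsGaussian.memLp_id (stdGaussian E) n (by simp)).integrable_norm_pow'

lemma stdGaussian_eq_withDensity :
    stdGaussian E = volume.withDensity fun x ↦
      ENNReal.ofReal ((2 * Real.pi) ^ (-(finrank ℝ E : ℝ) / 2) * Real.exp (-‖x‖ ^ 2 / 2)) := by
  set c : ℝ := (2 * Real.pi) ^ (-(finrank ℝ E : ℝ) / 2) with hc
  have hexp (x t : E) : Complex.exp (-(1 / 2) * ‖x‖ ^ 2 + Complex.I * inner ℝ t x)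
      = Real.exp (-‖x‖ ^ 2 / 2) * Complex.exp (inner ℝ x t * Complex.I) := by
    rw [Complex.ofReal_exp, ← Complex.exp_add, real_inner_comm]
    push_cast
    ring_nf
  have hint : Integrable fun x : E ↦ c * Real.exp (-‖x‖ ^ 2 / 2) := by
    have := (GaussianFourier.integrable_cexp_neg_mul_sq_norm_add (V := E) (b := 1 / 2)
      (by norm_num) Complex.I 0).norm
    simp only [hexp, norm_mul, Complex.norm_real, Complex.norm_exp_ofReal_mul_I, Real.norm_eq_abs,
      Real.abs_exp, mul_one] at this
    exact this.const_mul c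
  have hfin := isFiniteMeasure_withDensity_ofReal hint.2
  have hconst : (c : ℂ) * (Real.pi / (1 / 2)) ^ (finrank ℝ E / 2 : ℂ) = 1 := by
    rw [show (Real.pi / (1 / 2) : ℂ) = (2 * Real.pi : ℝ) by push_cast; ring,
      show (finrank ℝ E / 2 : ℂ) = (finrank ℝ E / 2 : ℝ) by push_cast; ring,
      ← Complex.ofReal_cpow (by positivity), ← Complex.ofReal_mul, hc,
      ← Real.rpow_add (by positivity)]
    simp [neg_div]
  refine Measure.ext_of_charFun (funext fun t ↦ ?_)
  have hval (x : E) : (ENNReal.ofReal (c * Real.exp (-‖x‖ ^ 2 / 2))).toReal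
      = c * Real.exp (-‖x‖ ^ 2 / 2) := ENNReal.toReal_ofReal (by positivity)
  rw [charFun_stdGaussian, charFun_apply,
    integral_withDensity_eq_integral_toReal_smul (by fun_prop) (by simp)]
  simp only [hval, mul_smul, Complex.real_smul, ← hexp]
  rw [integral_const_mul, GaussianFourier.integral_cexp_neg_mul_sq_norm_add (by norm_num),
    ← mul_assoc, hconst, one_mul, Complex.I_sq]
  ring_nf

lemma exists_integral_comp_norm_stdGaussian [Nontrivial E] :
    ∃ c : ℝ, ∀ g : ℝ → ℝ, ∫ u, g ‖u‖ ∂(stdGaussian E)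
      = c * ∫ y in Set.Ioi 0, y ^ (finrank ℝ E - 1) * (Real.exp (-y ^ 2 / 2) * g y) := by
  set c := (2 * Real.pi) ^ (-(finrank ℝ E : ℝ) / 2) with hc
  refine ⟨c * finrank ℝ E * volume.real (Metric.ball (0 : E) 1), fun g ↦ ?_⟩
  have hval (x : E) : (ENNReal.ofReal (c * Real.exp (-‖x‖ ^ 2 / 2))).toReal
      = c * Real.exp (-‖x‖ ^ 2 / 2) := ENNReal.toReal_ofReal (by positivity)
  rw [stdGaussian_eq_withDensity,
    integral_withDensity_eq_integral_toReal_smul (by fun_prop) (by simp)]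
  simp only [← hc, hval, smul_eq_mul, mul_assoc, integral_const_mul]
  rw [integral_fun_norm_addHaar volume fun y ↦ Real.exp (-y ^ 2 / 2) * g y]
  simp

lemma integral_norm_pow_add_two_stdGaussian [Nontrivial E] (n : ℕ) :
    ∫ u : E, ‖u‖ ^ (n + 2) ∂(stdGaussian E)
      = (finrank ℝ E + n) * ∫ u : E, ‖u‖ ^ n ∂(stdGaussian E) := by
  obtain ⟨c, hc⟩ := exists_integral_comp_norm_stdGaussian (E := E)
  have hd : 0 < (finrank ℝ E : ℝ) := by exact_mod_cast finrank_pos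
  have hradial (n : ℕ) :
      ∫ y in Set.Ioi 0, y ^ (finrank ℝ E - 1) * (Real.exp (-y ^ 2 / 2) * y ^ n)
        = (1 / 2 : ℝ) ^ (-((finrank ℝ E + n) / 2 : ℝ)) * (1 / 2)
          * Real.Gamma ((finrank ℝ E + n) / 2) := by
    have hGamma := integral_rpow_mul_exp_neg_mul_rpow (p := 2) (q := finrank ℝ E - 1 + n)
      (b := 1 / 2) (by norm_num) (by linarith [n.cast_nonneg (α := ℝ)]) (by norm_num)
    rw [sub_add_eq_add_sub, sub_add_cancel, neg_div] at hGamma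
    rw [← hGamma]
    refine setIntegral_congr_fun measurableSet_Ioi fun y _ ↦ ?_
    have hexponent : (finrank ℝ E + n - 1 : ℝ) = (finrank ℝ E - 1 + n : ℕ) := by
      push_cast [Nat.cast_pred (finrank_pos (R := ℝ) (M := E))]
      ring
    simp only [hexponent, Real.rpow_natCast, Real.rpow_two, pow_add]
    ring_nf
  rw [hc (· ^ (n + 2)), hc (· ^ n), hradial, hradial]
  push_cast
  have hs : ((finrank ℝ E : ℝ) + (n + 2)) / 2 = (finrank ℝ E + n) / 2 + 1 := by ring
  rw [hs, Real.Gamma_add_one (by positivity), neg_add, Real.rpow_add (by norm_num),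
    Real.rpow_neg_one]
  ring

end Gaussian

section Sphere

open scoped Pointwise

variable {d : ℕ}

lemma isProbabilityMeasure_sphereUniform (hd : 1 ≤ d) : IsProbabilityMeasure (sphereUniform d) := by
  have : Nonempty (Fin d) := ⟨⟨0, hd⟩⟩
  let σ := (volume : Measure (Vec d)).toSphere
  have hσ : σ Set.univ ≠ 0 := by
    simpa only [Ne, Measure.measure_univ_eq_zero] using
      (volume : Measure (Vec d)).toSphere_ne_zero
  have : IsProbabilityMeasure ((σ Set.univ)⁻¹ • σ) :=
    ⟨ENNReal.inv_mul_cancel hσ (measure_ne_top _ _)⟩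
  exact Measure.isProbabilityMeasure_map (by fun_prop)

lemma ae_norm_eq_one_sphereUniform : ∀ᵐ u ∂(sphereUniform d), ‖u‖ = 1 :=
  (ae_map_iff (by fun_prop) (measurableSet_eq_fun (by fun_prop) (by fun_prop))).2
    (.of_forall fun u ↦ by simp)

lemma sphereUniform_apply {A : Set (Vec d)} (hA : MeasurableSet A) :
    sphereUniform d A = ((volume : Measure (Vec d)).toSphere Set.univ)⁻¹ *
      (d * volume (Set.Ioo (0 : ℝ) 1 • (Metric.sphere (0 : Vec d) 1 ∩ A))) := by
  have hval : Measurable (Subtype.val : Metric.sphere (0 : Vec d) 1 → Vec d) := by fun_prop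
  rw [sphereUniform, Measure.map_apply hval hA, Measure.smul_apply, smul_eq_mul,
    Measure.toSphere_apply' _ (hval hA), Subtype.image_preimage_coe, finrank_euclideanSpace_fin]

lemma map_sphereUniform (e : Vec d ≃ₗᵢ[ℝ] Vec d) :
    (sphereUniform d).map e = sphereUniform d := by
  ext A hA
  have he : Measurable e := e.continuous.measurable
  have hpre : Set.Ioo (0 : ℝ) 1 • (Metric.sphere (0 : Vec d) 1 ∩ e ⁻¹' A)
      = e ⁻¹' (Set.Ioo (0 : ℝ) 1 • (Metric.sphere (0 : Vec d) 1 ∩ A)) := by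
    ext x
    simp only [Set.mem_smul, Set.mem_inter_iff, Set.mem_preimage, mem_sphere_zero_iff_norm]
    constructor
    · rintro ⟨r, hr, z, ⟨hz, hzA⟩, rfl⟩
      exact ⟨r, hr, e z, ⟨by simpa using hz, hzA⟩, by simp⟩
    · rintro ⟨r, hr, z, ⟨hz, hzA⟩, h⟩
      exact ⟨r, hr, e.symm z, ⟨by simpa using hz, by simpa using hzA⟩, e.injective (by simp [h])⟩
  rw [Measure.map_apply he hA, sphereUniform_apply (he hA), sphereUniform_apply hA, hpre]
  congr 2
  exact e.measurePreserving.measure_preimage_equiv (f := e.toMeasurableEquiv) _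

end Sphere

section Reflection

variable {E : Type*} [NormedAddCommGroup E] [InnerProductSpace ℝ E]

lemma inner_reflection_orthogonal_singleton (u v : E) :
    inner ℝ ((ℝ ∙ v)ᗮ.reflection u) v = -inner ℝ u v := by
  rw [← (ℝ ∙ v)ᗮ.reflection.inner_map_map u v,
    Submodule.reflection_orthogonalComplement_singleton_eq_neg, inner_neg_right, neg_neg]

lemma norm_sub_reflection_orthogonal_singleton_mul_norm (u v : E) :
    ‖u - (ℝ ∙ v)ᗮ.reflection u‖ * ‖v‖ = 2 * |inner ℝ u v| := by
  rcases eq_or_ne v 0 with rfl | hv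
  · simp
  have hv' : ‖v‖ ≠ 0 := norm_ne_zero_iff.2 hv
  have hsub : u - (ℝ ∙ v)ᗮ.reflection u = (2 * (inner ℝ v u / ‖v‖ ^ 2)) • v := by
    rw [Submodule.reflection_orthogonal_apply, Submodule.reflection_singleton_apply]
    simp [mul_smul, two_smul]
  rw [hsub, norm_smul, norm_mul, norm_div, real_inner_comm]
  simp only [Real.norm_eq_abs, Nat.abs_ofNat, norm_pow, abs_norm]
  field_simp

end Reflection

section RotationInvariant

variable {E : Type*} [NormedAddCommGroup E] [InnerProductSpace ℝ E] [MeasurableSpace E]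
  [BorelSpace E] {ρ : Measure E}

/-- The measure `ρ` is invariant under all linear isometries: the property shared by the Gaussian
and the spherical direction laws. -/
def IsRotationInvariant (ρ : Measure E) : Prop :=
  ∀ e : E ≃ₗᵢ[ℝ] E, ρ.map e = ρ

lemma IsRotationInvariant.measurePreserving (hρ : IsRotationInvariant ρ) (e : E ≃ₗᵢ[ℝ] E) :
    MeasurePreserving e ρ ρ :=
  ⟨e.continuous.measurable, hρ e⟩

lemma IsRotationInvariant.integral_comp (hρ : IsRotationInvariant ρ) (e : E ≃ₗᵢ[ℝ] E)
    {G : Type*} [NormedAddCommGroup G] [NormedSpace ℝ G] (φ : E → G) :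
    ∫ u, φ (e u) ∂ρ = ∫ u, φ u ∂ρ :=
  (hρ.measurePreserving e).integral_comp e.toHomeomorph.measurableEmbedding φ

lemma IsRotationInvariant.integral_norm_pow_mul_inner_sq_congr (hρ : IsRotationInvariant ρ)
    (k : ℕ) {v w : E} (hvw : ‖v‖ = ‖w‖) :
    ∫ u, ‖u‖ ^ k * inner ℝ u v ^ 2 ∂ρ = ∫ u, ‖u‖ ^ k * inner ℝ u w ^ 2 ∂ρ := by
  set e := (ℝ ∙ (v - w))ᗮ.reflection
  have hev : e v = w := Submodule.reflection_sub hvw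
  rw [← hρ.integral_comp e fun u ↦ ‖u‖ ^ k * inner ℝ u w ^ 2]
  simp only [e.norm_map, ← hev, e.inner_map_map]

lemma IsRotationInvariant.integral_mul_inner_eq_reflection (hρ : IsRotationInvariant ρ)
    {h : E → ℝ} (v : E) (hh : Integrable (fun u ↦ h u * inner ℝ u v) ρ) :
    Integrable (fun u ↦ (h u - h ((ℝ ∙ v)ᗮ.reflection u)) * inner ℝ u v) ρ ∧
      ∫ u, (h u - h ((ℝ ∙ v)ᗮ.reflection u)) * inner ℝ u v ∂ρ
        = 2 * ∫ u, h u * inner ℝ u v ∂ρ := by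
  set e := (ℝ ∙ v)ᗮ.reflection
  have hsplit (u : E) : (h u - h (e u)) * inner ℝ u v
      = h u * inner ℝ u v + h (e u) * inner ℝ (e u) v := by
    rw [inner_reflection_orthogonal_singleton]
    ring
  have hhe : Integrable (fun u ↦ h (e u) * inner ℝ (e u) v) ρ :=
    (hρ.measurePreserving e).integrable_comp_of_integrable hh
  simp only [hsplit]
  refine ⟨hh.add hhe, ?_⟩
  rw [integral_add hh hhe, hρ.integral_comp e fun u ↦ h u * inner ℝ u v, two_mul]

variable [FiniteDimensional ℝ E]

lemma integrable_norm_pow_mul_inner_sq {k : ℕ} (hint : Integrable (fun u ↦ ‖u‖ ^ (k + 2)) ρ)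
    (v : E) : Integrable (fun u ↦ ‖u‖ ^ k * inner ℝ u v ^ 2) ρ := by
  refine (hint.const_mul (‖v‖ ^ 2)).mono' (by fun_prop) (.of_forall fun u ↦ ?_)
  rw [Real.norm_of_nonneg (by positivity), ← sq_abs (inner ℝ u v)]
  calc ‖u‖ ^ k * |inner ℝ u v| ^ 2 ≤ ‖u‖ ^ k * (‖u‖ * ‖v‖) ^ 2 := by
        gcongr
        exact abs_real_inner_le_norm u v
    _ = ‖v‖ ^ 2 * ‖u‖ ^ (k + 2) := by ring

lemma IsRotationInvariant.integral_norm_pow_mul_inner_sq (hρ : IsRotationInvariant ρ) {k : ℕ}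
    (hint : Integrable (fun u ↦ ‖u‖ ^ (k + 2)) ρ) (v : E) :
    ∫ u, ‖u‖ ^ k * inner ℝ u v ^ 2 ∂ρ
      = (∫ u, ‖u‖ ^ (k + 2) ∂ρ) / Module.finrank ℝ E * ‖v‖ ^ 2 := by
  rcases subsingleton_or_nontrivial E with _ | _
  · simp [Subsingleton.elim v 0]
  have hE : (Module.finrank ℝ E : ℝ) ≠ 0 := by exact_mod_cast Module.finrank_pos.ne'
  let b := stdOrthonormalBasis ℝ E
  have hb (i) : ∫ u, ‖u‖ ^ k * inner ℝ u (‖v‖ • b i) ^ 2 ∂ρ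
      = ∫ u, ‖u‖ ^ k * inner ℝ u v ^ 2 ∂ρ :=
    hρ.integral_norm_pow_mul_inner_sq_congr k (by simp [norm_smul, b.norm_eq_one])
  have hparseval (u : E) : ∑ i, ‖u‖ ^ k * inner ℝ u (‖v‖ • b i) ^ 2
      = ‖v‖ ^ 2 * ‖u‖ ^ (k + 2) := by
    simp only [inner_smul_right, mul_pow, ← Finset.mul_sum, b.sum_sq_inner_left]
    ring
  have hsum : ∑ i, ∫ u, ‖u‖ ^ k * inner ℝ u (‖v‖ • b i) ^ 2 ∂ρ
      = ‖v‖ ^ 2 * ∫ u, ‖u‖ ^ (k + 2) ∂ρ := by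
    rw [← integral_finsetSum _ fun i _ ↦ integrable_norm_pow_mul_inner_sq hint _,
      ← integral_const_mul]
    simp only [hparseval]
  rw [Finset.sum_congr rfl fun i _ ↦ hb i, Finset.sum_const, Finset.card_univ, Fintype.card_fin,
    nsmul_eq_mul] at hsum
  field_simp
  linarith

lemma integrable_inner_smul (hint : Integrable (fun u ↦ ‖u‖ ^ 2) ρ) (a : E) :
    Integrable (fun u ↦ inner ℝ a u • u) ρ := by
  refine (hint.const_mul ‖a‖).mono' (by fun_prop) (.of_forall fun u ↦ ?_)
  rw [norm_smul]
  calc ‖(inner ℝ a u : ℝ)‖ * ‖u‖ ≤ ‖a‖ * ‖u‖ * ‖u‖ := by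
        gcongr
        exact norm_inner_le_norm a u
    _ = ‖a‖ * ‖u‖ ^ 2 := by ring

lemma IsRotationInvariant.integral_inner_smul (hρ : IsRotationInvariant ρ)
    (hint : Integrable (fun u ↦ ‖u‖ ^ 2) ρ) (a : E) :
    ∫ u, inner ℝ a u • u ∂ρ = ((∫ u, ‖u‖ ^ 2 ∂ρ) / Module.finrank ℝ E) • a := by
  refine ext_inner_left ℝ fun v ↦ ?_
  have hsq (w : E) : Integrable (fun u ↦ inner ℝ u w ^ 2) ρ := by
    simpa using integrable_norm_pow_mul_inner_sq (k := 0) hint w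
  have hval (w : E) :
      ∫ u, inner ℝ u w ^ 2 ∂ρ = (∫ u, ‖u‖ ^ 2 ∂ρ) / Module.finrank ℝ E * ‖w‖ ^ 2 := by
    simpa using hρ.integral_norm_pow_mul_inner_sq (k := 0) hint w
  have hpolar (u : E) : inner ℝ v (inner ℝ a u • u)
      = 1 / 2 * (inner ℝ u (a + v) ^ 2 - inner ℝ u a ^ 2 - inner ℝ u v ^ 2) := by
    rw [inner_smul_right, inner_add_right, real_inner_comm u a, real_inner_comm u v]
    ring
  rw [← integral_inner (integrable_inner_smul hint a)]
  simp only [hpolar]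
  rw [integral_const_mul, integral_sub (by exact (hsq _).sub (hsq _)) (hsq _),
    integral_sub (hsq _) (hsq _), hval, hval, hval, norm_add_sq_real, inner_smul_right,
    real_inner_comm]
  ring

lemma IsRotationInvariant.norm_mul_integral_mul_inner_le (hρ : IsRotationInvariant ρ)
    (hint : Integrable (fun u ↦ ‖u‖ ^ 4) ρ) {h : E → ℝ} {K : ℝ}
    (hosc : ∀ u u', ‖u'‖ ≤ ‖u‖ → |h u - h u'| ≤ K * ‖u‖ ^ 2 * ‖u - u'‖) (v : E)
    (hh : Integrable (fun u ↦ h u * inner ℝ u v) ρ) :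
    ‖v‖ * ∫ u, h u * inner ℝ u v ∂ρ
      ≤ K * ((∫ u, ‖u‖ ^ 4 ∂ρ) / Module.finrank ℝ E) * ‖v‖ ^ 2 := by
  set e := (ℝ ∙ v)ᗮ.reflection
  obtain ⟨hdiff, hval⟩ := hρ.integral_mul_inner_eq_reflection v hh
  have hpoint (u : E) : ‖v‖ * ((h u - h (e u)) * inner ℝ u v)
      ≤ 2 * K * (‖u‖ ^ 2 * inner ℝ u v ^ 2) := by
    calc ‖v‖ * ((h u - h (e u)) * inner ℝ u v)
        ≤ ‖v‖ * (|h u - h (e u)| * |inner ℝ u v|) := by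
          rw [← abs_mul]
          gcongr
          exact le_abs_self _
      _ ≤ ‖v‖ * (K * ‖u‖ ^ 2 * ‖u - e u‖ * |inner ℝ u v|) := by
          gcongr
          exact hosc u (e u) (by simp)
      _ = K * ‖u‖ ^ 2 * (‖u - e u‖ * ‖v‖) * |inner ℝ u v| := by ring
      _ = 2 * K * (‖u‖ ^ 2 * inner ℝ u v ^ 2) := by
          rw [norm_sub_reflection_orthogonal_singleton_mul_norm, ← sq_abs (inner ℝ u v)]
          ring
  have hmono := integral_mono (hdiff.const_mul ‖v‖)
    ((integrable_norm_pow_mul_inner_sq (k := 2) hint v).const_mul (2 * K)) hpoint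
  rw [integral_const_mul, integral_const_mul, hval,
    hρ.integral_norm_pow_mul_inner_sq (k := 2) hint] at hmono
  linarith

end RotationInvariant

section DirTerm

variable {E : Type*} [NormedAddCommGroup E] {h : E → ℝ} {K : ℝ}

/-- The bounds on the error `h(u)` of a central difference quotient in direction `u` which the
descent estimates rely on. For a function with `M`-Lipschitz Hessian and difference parameter `ν`
they hold with `K = M ν² / 2`. -/
structure IsDifferenceError (K : ℝ) (h : E → ℝ) : Prop where
  nonneg : 0 ≤ K
  continuous : Continuous h
  abs_le : ∀ u, |h u| ≤ K / 3 * ‖u‖ ^ 3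
  abs_sub_le : ∀ u u', ‖u'‖ ≤ ‖u‖ → |h u - h u'| ≤ K * ‖u‖ ^ 2 * ‖u - u'‖

variable [InnerProductSpace ℝ E]

/-- The contribution of the direction `u` to the estimator of a gradient `a`, where `h` is the
error of the difference quotient. -/
noncomputable def dirTerm (a : E) (h : E → ℝ) (u : E) : E :=
  (inner ℝ a u + h u) • u

/-- The estimator of a gradient `a` with scaling `γ` along the directions `u`, where `h` is the
error of the difference quotient. -/
noncomputable def dirSum {ι : Type*} [Fintype ι] (γ : ℝ) (a : E) (h : E → ℝ) (u : ι → E) : E :=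
  γ • ∑ j, dirTerm a h (u j)

lemma IsDifferenceError.norm_smul_le (hh : IsDifferenceError K h) (u : E) :
    ‖h u • u‖ ≤ K / 3 * ‖u‖ ^ 4 := by
  rw [norm_smul, Real.norm_eq_abs]
  calc |h u| * ‖u‖ ≤ K / 3 * ‖u‖ ^ 3 * ‖u‖ := by
        gcongr
        exact hh.abs_le u
    _ = K / 3 * ‖u‖ ^ 4 := by ring

lemma IsDifferenceError.norm_dirTerm_sq_le (hh : IsDifferenceError K h) (a u : E) :
    ‖dirTerm a h u‖ ^ 2
      ≤ 2 * (‖u‖ ^ 2 * inner ℝ u a ^ 2) + 2 * (K / 3) ^ 2 * ‖u‖ ^ 8 := by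
  have hsq : h u ^ 2 ≤ (K / 3 * ‖u‖ ^ 3) ^ 2 := by
    rw [← sq_abs]
    gcongr
    exact hh.abs_le u
  rw [dirTerm, norm_smul, mul_pow, Real.norm_eq_abs, sq_abs, real_inner_comm]
  calc (inner ℝ u a + h u) ^ 2 * ‖u‖ ^ 2
      ≤ (2 * inner ℝ u a ^ 2 + 2 * (K / 3 * ‖u‖ ^ 3) ^ 2) * ‖u‖ ^ 2 := by
        gcongr
        nlinarith [sq_nonneg (inner ℝ u a - h u)]
    _ = 2 * (‖u‖ ^ 2 * inner ℝ u a ^ 2) + 2 * (K / 3) ^ 2 * ‖u‖ ^ 8 := by ring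

lemma IsDifferenceError.continuous_dirTerm (hh : IsDifferenceError K h) (a : E) :
    Continuous (dirTerm a h) := by
  have := hh.continuous
  unfold dirTerm
  fun_prop

variable [MeasurableSpace E] {ρ : Measure E}

lemma IsDifferenceError.norm_integral_smul_le (hh : IsDifferenceError K h)
    (hint : Integrable (fun u ↦ ‖u‖ ^ 4) ρ) :
    ‖∫ u, h u • u ∂ρ‖ ≤ K / 3 * ∫ u, ‖u‖ ^ 4 ∂ρ := by
  rw [← integral_const_mul]
  exact norm_integral_le_of_norm_le (hint.const_mul _) (.of_forall hh.norm_smul_le)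

variable [FiniteDimensional ℝ E] [BorelSpace E]

lemma IsDifferenceError.integrable_smul (hh : IsDifferenceError K h)
    (hint : Integrable (fun u ↦ ‖u‖ ^ 4) ρ) : Integrable (fun u ↦ h u • u) ρ :=
  (hint.const_mul (K / 3)).mono' (hh.continuous.smul continuous_id).aestronglyMeasurable
    (.of_forall hh.norm_smul_le)

lemma IsRotationInvariant.norm_integral_smul_le (hρ : IsRotationInvariant ρ)
    (hh : IsDifferenceError K h) (hint : Integrable (fun u ↦ ‖u‖ ^ 4) ρ) :
    ‖∫ u, h u • u ∂ρ‖ ≤ K * ((∫ u, ‖u‖ ^ 4 ∂ρ) / Module.finrank ℝ E) := by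
  set b := ∫ u, h u • u ∂ρ with hb
  have hcomm (u : E) : inner ℝ b (h u • u) = h u * inner ℝ u b := by
    rw [inner_smul_right, real_inner_comm]
  have hinner : Integrable (fun u ↦ h u * inner ℝ u b) ρ := by
    simpa only [hcomm] using (hh.integrable_smul hint).const_inner (𝕜 := ℝ) b
  have hself : ∫ u, h u * inner ℝ u b ∂ρ = ‖b‖ ^ 2 := by
    rw [← real_inner_self_eq_norm_sq, hb, ← integral_inner (𝕜 := ℝ) (hh.integrable_smul hint), ← hb]
    simp only [hcomm]
  have hle := hρ.norm_mul_integral_mul_inner_le hint hh.abs_sub_le b hinner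
  rw [hself] at hle
  rcases eq_or_ne b 0 with hb0 | hb0
  · rw [hb0, norm_zero]
    have := hh.nonneg
    positivity
  · exact le_of_mul_le_mul_right hle (pow_pos (norm_pos_iff.2 hb0) 2)

lemma IsDifferenceError.memLp_dirTerm (hh : IsDifferenceError K h)
    (hint : ∀ k : ℕ, Integrable (fun u ↦ ‖u‖ ^ k) ρ) (a : E) : MemLp (dirTerm a h) 2 ρ := by
  have hcont := hh.continuous_dirTerm a
  rw [memLp_two_iff_integrable_sq_norm hcont.aestronglyMeasurable]
  refine (((integrable_norm_pow_mul_inner_sq (hint 4) a).const_mul 2).add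
    ((hint 8).const_mul (2 * (K / 3) ^ 2))).mono' (by fun_prop) (.of_forall fun u ↦ ?_)
  rw [Real.norm_of_nonneg (by positivity)]
  exact hh.norm_dirTerm_sq_le a u

lemma IsRotationInvariant.integral_norm_dirTerm_sq_le (hρ : IsRotationInvariant ρ)
    (hh : IsDifferenceError K h) (hint : ∀ k : ℕ, Integrable (fun u ↦ ‖u‖ ^ k) ρ) (a : E) :
    ∫ u, ‖dirTerm a h u‖ ^ 2 ∂ρ
      ≤ 2 * ((∫ u, ‖u‖ ^ 4 ∂ρ) / Module.finrank ℝ E) * ‖a‖ ^ 2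
        + 2 * ((K / 3) ^ 2 * ∫ u, ‖u‖ ^ 8 ∂ρ) := by
  have hlin := (integrable_norm_pow_mul_inner_sq (hint 4) a).const_mul 2
  have herr := (hint 8).const_mul (2 * (K / 3) ^ 2)
  calc ∫ u, ‖dirTerm a h u‖ ^ 2 ∂ρ
      ≤ ∫ u, 2 * (‖u‖ ^ 2 * inner ℝ u a ^ 2) + 2 * (K / 3) ^ 2 * ‖u‖ ^ 8 ∂ρ :=
        integral_mono ((hh.memLp_dirTerm hint a).integrable_norm_pow two_ne_zero) (hlin.add herr)
          (hh.norm_dirTerm_sq_le a)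
    _ = _ := by
        rw [integral_add hlin herr, integral_const_mul, integral_const_mul,
          hρ.integral_norm_pow_mul_inner_sq (hint 4)]
        ring

lemma IsRotationInvariant.integral_dirTerm (hρ : IsRotationInvariant ρ)
    (hh : IsDifferenceError K h) (hint : ∀ k : ℕ, Integrable (fun u ↦ ‖u‖ ^ k) ρ) (a : E) :
    ∫ u, dirTerm a h u ∂ρ
      = ((∫ u, ‖u‖ ^ 2 ∂ρ) / Module.finrank ℝ E) • a + ∫ u, h u • u ∂ρ := by
  simp only [dirTerm, add_smul]
  rw [integral_add (integrable_inner_smul (hint 2) a) (hh.integrable_smul (hint 4)),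
    hρ.integral_inner_smul (hint 2)]

end DirTerm

section ModelChange

variable {E : Type*} [NormedAddCommGroup E] [InnerProductSpace ℝ E]

/-- The change `-⟨a, g⟩ + (c/8) ‖g‖²`, per unit of step size, of the quadratic upper model of a
function with gradient `a` after a step along `-g`. The factor `c` is the ratio of the step size
bound to `Ω₁`. -/
noncomputable def modelChange (c : ℝ) (a g : E) : ℝ :=
  -inner ℝ a g + c / 8 * ‖g‖ ^ 2

lemma integrable_modelChange {X : Type*} [MeasurableSpace X] {ρ : Measure X} [IsFiniteMeasure ρ]
    (c : ℝ) (a : E) {g : X → E} (hg : MemLp g 2 ρ) :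
    Integrable (fun x ↦ modelChange c a (g x)) ρ :=
  ((hg.integrable one_le_two).const_inner a).neg.add (hg.integrable_norm_pow'.const_mul _)

lemma neg_inner_add_le_of_norm_sub_le {a e : E} {c r t D s p q : ℝ} (hD : ‖e - a‖ ≤ D)
    (hc : 0 ≤ c) (hr : 0 ≤ r) (ht : 0 ≤ t) (hs : s ≤ 2 * p * ‖a‖ ^ 2 + 2 * q)
    (hcrt : c * (r * p + t) ≤ 1) :
    -inner ℝ a e + c / 8 * (r * s + t * ‖e‖ ^ 2)
      ≤ -(1 / 4) * ‖a‖ ^ 2 + (1 / 2 * D ^ 2 + c / 4 * (r * q + t * D ^ 2)) := by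
  have hDsq : ‖e - a‖ ^ 2 ≤ D ^ 2 := by gcongr
  have hinner : -inner ℝ a e ≤ -(1 / 2) * ‖a‖ ^ 2 + 1 / 2 * D ^ 2 := by
    rw [norm_sub_sq_real, real_inner_comm] at hDsq
    linarith [sq_nonneg ‖e‖]
  have hnorm : ‖e‖ ^ 2 ≤ 2 * ‖a‖ ^ 2 + 2 * D ^ 2 := by
    have hsum := parallelogram_law_with_norm ℝ a (e - a)
    rw [add_sub_cancel] at hsum
    nlinarith [sq_nonneg ‖a - (e - a)‖]
  have hmodel : c / 8 * (r * s + t * ‖e‖ ^ 2)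
      ≤ c / 8 * (r * (2 * p * ‖a‖ ^ 2 + 2 * q) + t * (2 * ‖a‖ ^ 2 + 2 * D ^ 2)) := by gcongr
  have hcoef := mul_le_mul_of_nonneg_right hcrt (by positivity : 0 ≤ 1 / 4 * ‖a‖ ^ 2)
  linarith

end ModelChange

section Independent

variable {E : Type*} [NormedAddCommGroup E] [InnerProductSpace ℝ E] [CompleteSpace E]
  [MeasurableSpace E] [BorelSpace E] {ι X : Type*} [Fintype ι] [MeasurableSpace X] {ρ : Measure X}
  [IsProbabilityMeasure ρ]

lemma integral_modelChange_mean_pi [Nonempty ι] {w : X → E} (hw : MemLp w 2 ρ) (l c : ℝ) (a : E) :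
    ∫ u : ι → X, modelChange c a ((l / Fintype.card ι) • ∑ j, w (u j)) ∂(Measure.pi fun _ ↦ ρ)
      = -inner ℝ a (l • ∫ x, w x ∂ρ) + c / 8 * (l ^ 2 / Fintype.card ι * ∫ x, ‖w x‖ ^ 2 ∂ρ
        + (Fintype.card ι - 1) / Fintype.card ι * ‖l • ∫ x, w x ∂ρ‖ ^ 2) := by
  have hcard : (Fintype.card ι : ℝ) ≠ 0 := by exact_mod_cast Fintype.card_ne_zero
  have hsum : MemLp (fun u : ι → X ↦ ∑ j, w (u j)) 2 (Measure.pi fun _ ↦ ρ) :=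
    memLp_finsetSum _ fun j _ ↦ memLp_comp_eval_pi hw j
  have hsum1 := hsum.integrable one_le_two
  simp only [modelChange, norm_smul, mul_pow, inner_smul_right, Real.norm_eq_abs, sq_abs]
  rw [integral_add (by exact ((hsum1.const_inner a).const_mul _).neg)
      ((hsum.integrable_norm_pow'.const_mul _).const_mul _), integral_neg, integral_const_mul,
    integral_const_mul, integral_const_mul, integral_inner hsum1,
    integral_sum_comp_eval_pi (hw.integrable one_le_two), integral_norm_sum_sq_pi hw,
    ← Nat.cast_smul_eq_nsmul ℝ, inner_smul_right]
  field_simp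

end Independent

section Estimates

variable {E : Type*} [NormedAddCommGroup E] [InnerProductSpace ℝ E] [FiniteDimensional ℝ E]
  [MeasurableSpace E] [BorelSpace E] {ι : Type*} [Fintype ι] {h : E → ℝ} {K : ℝ}

lemma IsRotationInvariant.integral_modelChange_dirSum_le [Nonempty ι] [Nontrivial E]
    {ρ : Measure E} [IsProbabilityMeasure ρ] (hρ : IsRotationInvariant ρ)
    (hint : ∀ k : ℕ, Integrable (fun u ↦ ‖u‖ ^ k) ρ) (hh : IsDifferenceError K h) {l c D : ℝ}
    (hl : l * ∫ u, ‖u‖ ^ 2 ∂ρ = Module.finrank ℝ E) (hD : ‖l • ∫ u, h u • u ∂ρ‖ ≤ D)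
    (hc : 0 ≤ c)
    (hcl : c * (l ^ 2 / Fintype.card ι * ((∫ u, ‖u‖ ^ 4 ∂ρ) / Module.finrank ℝ E)
      + (Fintype.card ι - 1) / Fintype.card ι) ≤ 1) (a : E) :
    ∫ u : ι → E, modelChange c a (dirSum (l / Fintype.card ι) a h u) ∂(Measure.pi fun _ ↦ ρ)
      ≤ -(1 / 4) * ‖a‖ ^ 2 + (1 / 2 * D ^ 2
        + c / 4 * (l ^ 2 / Fintype.card ι * ((K / 3) ^ 2 * ∫ u, ‖u‖ ^ 8 ∂ρ)
          + (Fintype.card ι - 1) / Fintype.card ι * D ^ 2)) := by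
  have hE : (Module.finrank ℝ E : ℝ) ≠ 0 := by exact_mod_cast Module.finrank_pos.ne'
  have hcard : (1 : ℝ) ≤ Fintype.card ι := by exact_mod_cast Fintype.card_pos
  have hbias : l • ∫ u, dirTerm a h u ∂ρ - a = l • ∫ u, h u • u ∂ρ := by
    rw [hρ.integral_dirTerm hh hint, smul_add, smul_smul, ← mul_div_assoc, hl, div_self hE,
      one_smul, add_sub_cancel_left]
  simp only [dirSum]
  rw [integral_modelChange_mean_pi (hh.memLp_dirTerm hint a)]
  exact neg_inner_add_le_of_norm_sub_le (hbias ▸ hD) hc (by positivity)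
    (div_nonneg (by linarith) (by linarith)) (hρ.integral_norm_dirTerm_sq_le hh hint a) hcl

omit [FiniteDimensional ℝ E] [MeasurableSpace E] [BorelSpace E] in
lemma modelChange_dirSum_le_of_orthonormal {u : ι → E} (hu : Orthonormal ℝ u)
    (hh : IsDifferenceError K h) {γ : ℝ} (hγ : 0 < γ) (a : E) :
    modelChange γ⁻¹ a (dirSum γ a h u)
      ≤ -(1 / 4) * γ * ∑ j, inner ℝ (u j) a ^ 2
        + 3 / 4 * (γ * Fintype.card ι) * (K / 3) ^ 2 := by
  have hsq : ‖∑ j, dirTerm a h (u j)‖ ^ 2 = ∑ j, (inner ℝ a (u j) + h (u j)) ^ 2 := by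
    rw [← real_inner_self_eq_norm_sq]
    simp only [dirTerm]
    rw [hu.inner_sum]
    simp [sq]
  have hterm (j) : -(inner ℝ a (u j) + h (u j)) * inner ℝ a (u j)
        + 1 / 8 * (inner ℝ a (u j) + h (u j)) ^ 2
      ≤ -(1 / 4) * inner ℝ (u j) a ^ 2 + 3 / 4 * (K / 3) ^ 2 := by
    have herr : |h (u j)| ≤ K / 3 := by simpa [hu.1 j] using hh.abs_le (u j)
    have herr_sq : h (u j) ^ 2 ≤ (K / 3) ^ 2 := by
      rw [← sq_abs]
      gcongr
    rw [real_inner_comm]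
    nlinarith [sq_nonneg (inner ℝ (u j) a + h (u j))]
  calc modelChange γ⁻¹ a (dirSum γ a h u)
      = γ * ∑ j, (-(inner ℝ a (u j) + h (u j)) * inner ℝ a (u j)
          + 1 / 8 * (inner ℝ a (u j) + h (u j)) ^ 2) := by
        rw [modelChange, dirSum, norm_smul, mul_pow, hsq, inner_smul_right, inner_sum,
          Real.norm_eq_abs, sq_abs, Finset.sum_add_distrib, ← Finset.mul_sum]
        simp only [dirTerm, inner_smul_right, neg_mul, Finset.sum_neg_distrib]
        field_simp
    _ ≤ γ * ∑ j, (-(1 / 4) * inner ℝ (u j) a ^ 2 + 3 / 4 * (K / 3) ^ 2) := by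
        exact mul_le_mul_of_nonneg_left (Finset.sum_le_sum fun j _ ↦ hterm j) hγ.le
    _ = _ := by
        rw [Finset.sum_add_distrib, ← Finset.mul_sum, Finset.sum_const, Finset.card_univ,
          nsmul_eq_mul]
        ring

variable {τ : Measure (ι → E)} [IsProbabilityMeasure τ]

lemma memLp_dirSum_of_orthonormal (hτ : ∀ᵐ u ∂τ, Orthonormal ℝ u) (hh : IsDifferenceError K h)
    (γ : ℝ) (a : E) : MemLp (dirSum γ a h) 2 τ := by
  have hcont := hh.continuous_dirTerm a
  have hcontSum : Continuous (dirSum (ι := ι) γ a h) :=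
    (continuous_finsetSum _ fun j _ ↦ hcont.comp (continuous_apply j)).const_smul γ
  refine MemLp.of_bound hcontSum.aestronglyMeasurable (‖γ‖ * ∑ _j : ι, (‖a‖ + K / 3)) ?_
  filter_upwards [hτ] with u hu
  rw [dirSum, norm_smul]
  gcongr
  refine (norm_sum_le _ _).trans (Finset.sum_le_sum fun j _ ↦ ?_)
  have hlin : |inner ℝ a (u j)| ≤ ‖a‖ := by simpa [hu.1 j] using abs_real_inner_le_norm a (u j)
  have herr : |h (u j)| ≤ K / 3 := by simpa [hu.1 j] using hh.abs_le (u j)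
  rw [dirTerm, norm_smul, hu.1 j, mul_one, Real.norm_eq_abs]
  exact (abs_add_le _ _).trans (add_le_add hlin herr)

lemma integral_modelChange_dirSum_le_of_orthonormal (hτ : ∀ᵐ u ∂τ, Orthonormal ℝ u)
    (hh : IsDifferenceError K h) {γ : ℝ} (hγ : 0 < γ) {a : E}
    (hiso : ∫ u, ∑ j, inner ℝ (u j) a ^ 2 ∂τ = γ⁻¹ * ‖a‖ ^ 2) :
    ∫ u, modelChange γ⁻¹ a (dirSum γ a h u) ∂τ
      ≤ -(1 / 4) * ‖a‖ ^ 2 + 3 / 4 * (γ * Fintype.card ι) * (K / 3) ^ 2 := by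
  have hbessel : Integrable (fun u : ι → E ↦ ∑ j, inner ℝ (u j) a ^ 2) τ := by
    refine Integrable.of_bound (C := ‖a‖ ^ 2)
      (Continuous.aestronglyMeasurable (by fun_prop)) ?_
    filter_upwards [hτ] with u hu
    rw [Real.norm_of_nonneg (by positivity)]
    simpa using hu.sum_inner_products_le a (s := Finset.univ)
  calc ∫ u, modelChange γ⁻¹ a (dirSum γ a h u) ∂τ
      ≤ ∫ u, (-(1 / 4) * γ * ∑ j, inner ℝ (u j) a ^ 2
          + 3 / 4 * (γ * Fintype.card ι) * (K / 3) ^ 2) ∂τ := by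
        refine integral_mono_ae
          (integrable_modelChange _ a (memLp_dirSum_of_orthonormal hτ hh γ a))
          ((hbessel.const_mul _).add (integrable_const _)) ?_
        filter_upwards [hτ] with u hu using modelChange_dirSum_le_of_orthonormal hu hh hγ a
    _ = _ := by
        rw [integral_add (hbessel.const_mul _) (integrable_const _), integral_const_mul, hiso,
          integral_const, probReal_univ, one_smul]
        field_simp

end Estimates

section StepFactor

/-- The ratio `ᾱ / Ω₁` of the step size bound to `Ω₁`, which is free of `θ` and `L`. -/
noncomputable def stepFactor (m : Scheme) (d N : ℕ) : ℝ :=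
  match m with
  | .cFD => 1
  | .cGS => N / (N + 4.5 * d)
  | .cSS => N / (N + 4.5 * d)
  | .cRC => N / d
  | .cRS => N / d

lemma alphaBar_eq_stepFactor_mul (m : Scheme) (d N : ℕ) (θ L : ℝ) :
    alphaBar m d N θ L = stepFactor m d N * Omega₁ θ L := by
  cases m <;> simp [alphaBar, stepFactor]

lemma stepFactor_pos (m : Scheme) {d N : ℕ} (hd : 1 ≤ d) (hN : 1 ≤ N) : 0 < stepFactor m d N := by
  cases m <;> simp only [stepFactor] <;> positivity

lemma alphaBar_pos (m : Scheme) {d N : ℕ} (hd : 1 ≤ d) (hN : 1 ≤ N) (θ : ℝ) {L : ℝ} (hL : 0 < L) :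
    0 < alphaBar m d N θ L := by
  have hΩ : 0 < Omega₁ θ L := by unfold Omega₁; positivity
  rw [alphaBar_eq_stepFactor_mul]
  exact mul_pos (stepFactor_pos m hd hN) hΩ

lemma chi_pos (m : Scheme) {d : ℕ} (hd : 1 ≤ d) (N : ℕ) {M ν : ℝ} (hM : 0 < M) (hν : 0 < ν) :
    0 < chi m d N M ν := by
  have hΩ : 0 < Omega₂ d M ν := by unfold Omega₂; positivity
  cases m <;> simp only [chi] <;> positivity

lemma Omega₂_eq_mul_sq (d : ℕ) (M ν : ℝ) :
    Omega₂ d M ν = d * ((M * ν ^ 2 / 2) ^ 2 / 12) := by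
  rw [Omega₂]
  ring

end StepFactor

section CoordinateDirections

variable {d N : ℕ} {τ : Measure (Fin N → Vec d)}

lemma inner_stdVec (j : Fin d) (v : Vec d) : inner ℝ (stdVec j) v = v j := by
  simp [stdVec, EuclideanSpace.inner_single_left]

lemma orthonormal_stdVec_comp {ι : Type*} {e : ι → Fin d} (he : Function.Injective e) :
    Orthonormal ℝ fun j ↦ (stdVec (e j) : Vec d) := by
  simpa [Function.comp_def, stdVec] using
    (EuclideanSpace.basisFun (Fin d) ℝ).orthonormal.comp e he

lemma IsDirectionLaw.cRS_of_cFD (h : IsDirectionLaw .cFD τ) : IsDirectionLaw .cRS τ := by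
  obtain ⟨rfl, rfl⟩ := h
  refine ⟨?_, fun v ↦ ?_⟩
  · rw [ae_dirac_eq]
    exact orthonormal_stdVec_comp (Fin.cast_injective rfl)
  · rw [integral_dirac]
    simp only [Fin.cast_eq_self, inner_stdVec, ← EuclideanSpace.real_norm_sq_eq]
    rcases Nat.eq_zero_or_pos N with rfl | hN
    · simp [Subsingleton.elim v 0]
    · field_simp

lemma card_mul_sum_embedding_apply (g : Fin d → ℝ) (j : Fin N) :
    (d : ℝ) * ∑ e : Fin N ↪ Fin d, g (e j) = Fintype.card (Fin N ↪ Fin d) * ∑ i, g i := by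
  rcases d.eq_zero_or_pos with rfl | hd
  · simp
  have : NeZero d := ⟨hd.ne'⟩
  have hshift (s : Fin d) :
      ∑ e : Fin N ↪ Fin d, g (e j) = ∑ e : Fin N ↪ Fin d, g (e j + s) :=
    (Fintype.sum_equiv (Equiv.embeddingCongr (Equiv.refl (Fin N)) (Equiv.addRight s)) _ _
      (fun e ↦ by simp)).symm
  calc (d : ℝ) * ∑ e : Fin N ↪ Fin d, g (e j)
      = ∑ s : Fin d, ∑ e : Fin N ↪ Fin d, g (e j + s) := by
        rw [← Finset.sum_congr rfl fun s _ ↦ hshift s]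
        simp
    _ = ∑ e : Fin N ↪ Fin d, ∑ i, g i := by
        rw [Finset.sum_comm]
        exact Finset.sum_congr rfl fun e _ ↦ Equiv.sum_comp (Equiv.addLeft (e j)) g
    _ = Fintype.card (Fin N ↪ Fin d) * ∑ i, g i := by simp

lemma IsDirectionLaw.cRS_of_cRC [IsProbabilityMeasure τ] (hd : 1 ≤ d)
    (h : IsDirectionLaw .cRC τ) : IsDirectionLaw .cRS τ := by
  have hτ : τ = (Fintype.card (Fin N ↪ Fin d) : ENNReal)⁻¹ •
      ∑ e : Fin N ↪ Fin d, Measure.dirac (fun j ↦ (stdVec (e j) : Vec d)) := h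
  have hcard : (Fintype.card (Fin N ↪ Fin d) : ℝ) ≠ 0 := by
    intro h0
    have : IsEmpty (Fin N ↪ Fin d) := Fintype.card_eq_zero_iff.1 (by exact_mod_cast h0)
    exact IsProbabilityMeasure.ne_zero τ (by simp [hτ])
  refine ⟨?_, fun v ↦ ?_⟩
  · rw [hτ]
    refine Measure.ae_smul_measure ?_ _
    rw [← Measure.sum_fintype, Measure.ae_sum_iff]
    intro e
    rw [ae_dirac_eq]
    exact orthonormal_stdVec_comp e.injective
  · have hentry (j : Fin N) : ∑ e : Fin N ↪ Fin d, v (e j) ^ 2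
        = Fintype.card (Fin N ↪ Fin d) / d * ‖v‖ ^ 2 := by
      rw [EuclideanSpace.real_norm_sq_eq, div_mul_eq_mul_div, eq_div_iff (by positivity), mul_comm,
        card_mul_sum_embedding_apply (fun i ↦ v i ^ 2) j]
    rw [hτ, integral_smul_measure, integral_finsetSum_measure fun e _ ↦ integrable_dirac (by simp)]
    simp only [integral_dirac, inner_stdVec]
    rw [Finset.sum_comm]
    simp only [hentry, Finset.sum_const, Finset.card_univ, Fintype.card_fin, nsmul_eq_mul,
      ENNReal.toReal_inv, ENNReal.toReal_natCast, smul_eq_mul]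
    field_simp

end CoordinateDirections

section Moments

lemma integrable_norm_pow_of_ae_norm_eq_one {E : Type*} [NormedAddCommGroup E] [MeasurableSpace E]
    {ρ : Measure E} [IsFiniteMeasure ρ] (hρ : ∀ᵐ u ∂ρ, ‖u‖ = 1) (k : ℕ) :
    Integrable (fun u ↦ ‖u‖ ^ k) ρ := by
  refine (integrable_const (1 : ℝ)).congr ?_
  filter_upwards [hρ] with u hu
  rw [hu, one_pow]

lemma integral_norm_pow_sphereUniform {d : ℕ} (hd : 1 ≤ d) (k : ℕ) :
    ∫ u : Vec d, ‖u‖ ^ k ∂(sphereUniform d) = 1 := by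
  have := isProbabilityMeasure_sphereUniform hd
  have hone : (fun u : Vec d ↦ ‖u‖ ^ k) =ᵐ[sphereUniform d] fun _ ↦ 1 := by
    filter_upwards [ae_norm_eq_one_sphereUniform] with u hu
    rw [hu, one_pow]
  rw [integral_congr_ae hone]
  simp

lemma integrable_norm_pow_sphereUniform {d : ℕ} (hd : 1 ≤ d) (k : ℕ) :
    Integrable (fun u : Vec d ↦ ‖u‖ ^ k) (sphereUniform d) :=
  have := isProbabilityMeasure_sphereUniform hd
  integrable_norm_pow_of_ae_norm_eq_one ae_norm_eq_one_sphereUniform k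

lemma isRotationInvariant_sphereUniform (d : ℕ) : IsRotationInvariant (sphereUniform d) :=
  map_sphereUniform

open Module

variable (E : Type*) [NormedAddCommGroup E] [InnerProductSpace ℝ E] [FiniteDimensional ℝ E]
  [MeasurableSpace E] [BorelSpace E]

lemma isRotationInvariant_stdGaussian : IsRotationInvariant (stdGaussian E) :=
  fun e ↦ stdGaussian_map e

variable [Nontrivial E]

lemma integral_norm_sq_stdGaussian : ∫ u : E, ‖u‖ ^ 2 ∂(stdGaussian E) = finrank ℝ E := by
  simpa using integral_norm_pow_add_two_stdGaussian (E := E) 0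

lemma integral_norm_pow_four_stdGaussian :
    ∫ u : E, ‖u‖ ^ 4 ∂(stdGaussian E) = finrank ℝ E * (finrank ℝ E + 2) := by
  rw [integral_norm_pow_add_two_stdGaussian 2, integral_norm_sq_stdGaussian]
  push_cast
  ring

lemma integral_norm_pow_eight_stdGaussian :
    ∫ u : E, ‖u‖ ^ 8 ∂(stdGaussian E)
      = finrank ℝ E * (finrank ℝ E + 2) * (finrank ℝ E + 4) * (finrank ℝ E + 6) := by
  rw [integral_norm_pow_add_two_stdGaussian 6, integral_norm_pow_add_two_stdGaussian 4,
    integral_norm_pow_four_stdGaussian]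
  push_cast
  ring

variable {E}

lemma IsDifferenceError.norm_integral_smul_stdGaussian_le {h : E → ℝ} {K : ℝ}
    (hh : IsDifferenceError K h) :
    ‖∫ u, h u • u ∂(stdGaussian E)‖ ≤ 2 * K * finrank ℝ E := by
  have hint := integrable_norm_pow_stdGaussian (E := E) 4
  have hK := hh.nonneg
  have hpos : 0 < finrank ℝ E := finrank_pos
  rcases eq_or_lt_of_le (Nat.one_le_iff_ne_zero.2 hpos.ne') with h1 | h2
  · have h1' : (finrank ℝ E : ℝ) = 1 := by exact_mod_cast h1.symm
    refine (hh.norm_integral_smul_le hint).trans ?_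
    rw [integral_norm_pow_four_stdGaussian, h1']
    linarith
  · have h2' : (2 : ℝ) ≤ finrank ℝ E := by exact_mod_cast h2
    refine ((isRotationInvariant_stdGaussian E).norm_integral_smul_le hh hint).trans ?_
    rw [integral_norm_pow_four_stdGaussian, mul_div_cancel_left₀ _ (by positivity)]
    nlinarith

end Moments

section DirectionLaw

variable {d N : ℕ} {τ : Measure (Fin N → Vec d)} {M ν : ℝ} {h : Vec d → ℝ}

lemma integral_modelChange_le_of_cRS [IsProbabilityMeasure τ] (hd : 1 ≤ d) (hN : 1 ≤ N)
    (hτ : IsDirectionLaw .cRS τ) (hh : IsDifferenceError (M * ν ^ 2 / 2) h) (a : Vec d) :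
    ∫ u, modelChange (N / d) a (dirSum (d / N) a h u) ∂τ
      ≤ -(1 / 4) * ‖a‖ ^ 2 + Omega₂ d M ν := by
  have hγ : (0 : ℝ) < d / N := by positivity
  have hmain := integral_modelChange_dirSum_le_of_orthonormal hτ.1 hh hγ (a := a)
    (by rw [inv_div, hτ.2 a])
  rw [inv_div, Fintype.card_fin, div_mul_cancel₀ _ (by positivity)] at hmain
  refine hmain.trans_eq ?_
  rw [Omega₂_eq_mul_sq]
  ring

lemma integral_modelChange_le_of_cGS (hd : 1 ≤ d) (hN : 1 ≤ N)
    (hh : IsDifferenceError (M * ν ^ 2 / 2) h) (a : Vec d) :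
    ∫ u : Fin N → Vec d, modelChange (N / (N + 4.5 * d)) a (dirSum (1 / N) a h u)
        ∂(Measure.pi fun _ ↦ stdGaussian (Vec d))
      ≤ -(1 / 4) * ‖a‖ ^ 2 + chi .cGS d N M ν := by
  have : Nonempty (Fin d) := Fin.pos_iff_nonempty.1 hd
  have : Nonempty (Fin N) := Fin.pos_iff_nonempty.1 hN
  have hd' : (1 : ℝ) ≤ d := by exact_mod_cast hd
  set K := M * ν ^ 2 / 2
  have hbias : ‖(1 : ℝ) • ∫ u, h u • u ∂(stdGaussian (Vec d))‖ ≤ 2 * K * d := by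
    simpa only [one_smul, finrank_euclideanSpace_fin] using hh.norm_integral_smul_stdGaussian_le
  have hmain := (isRotationInvariant_stdGaussian (Vec d)).integral_modelChange_dirSum_le
    (ι := Fin N) integrable_norm_pow_stdGaussian hh (c := N / (N + 4.5 * d))
    (by rw [one_mul, integral_norm_sq_stdGaussian]) hbias (by positivity)
    (by
      rw [integral_norm_pow_four_stdGaussian, finrank_euclideanSpace_fin, Fintype.card_fin]
      field_simp
      linarith) a
  rw [integral_norm_pow_eight_stdGaussian, finrank_euclideanSpace_fin, Fintype.card_fin] at hmain
  refine hmain.trans (add_le_add le_rfl ?_)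
  simp only [chi, Omega₂_eq_mul_sq]
  have hslack : (72 * N * d + 216 * (d : ℝ) ^ 2 + (d + 2) * (d + 4) * (d + 6))
        / (2 * (N + 4.5 * d)) * (d * (K ^ 2 / 12))
      - (1 / 2 * (2 * K * d) ^ 2 + N / (N + 4.5 * d) / 4
        * (1 ^ 2 / N * ((K / 3) ^ 2 * (d * (d + 2) * (d + 4) * (d + 6)))
          + (N - 1) / N * (2 * K * d) ^ 2))
      = (d * (d + 2) * (d + 4) * (d + 6) / 72 + d ^ 2) * K ^ 2 / (N + 4.5 * d) := by
    field_simp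
    ring
  rw [← sub_nonneg, hslack]
  positivity

lemma integral_modelChange_le_of_cSS (hd : 1 ≤ d) (hN : 1 ≤ N)
    (hh : IsDifferenceError (M * ν ^ 2 / 2) h) (a : Vec d) :
    ∫ u : Fin N → Vec d, modelChange (N / (N + 4.5 * d)) a (dirSum (d / N) a h u)
        ∂(Measure.pi fun _ ↦ sphereUniform d)
      ≤ -(1 / 4) * ‖a‖ ^ 2 + chi .cSS d N M ν := by
  have : Nonempty (Fin d) := Fin.pos_iff_nonempty.1 hd
  have : Nonempty (Fin N) := Fin.pos_iff_nonempty.1 hN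
  have := isProbabilityMeasure_sphereUniform hd
  have hinv := isRotationInvariant_sphereUniform d
  have hint := integrable_norm_pow_sphereUniform hd
  have hmoment := integral_norm_pow_sphereUniform hd
  set K := M * ν ^ 2 / 2
  have hbias : ‖(d : ℝ) • ∫ u, h u • u ∂(sphereUniform d)‖ ≤ 2 * K := by
    have hle := hinv.norm_integral_smul_le hh (hint 4)
    rw [hmoment, finrank_euclideanSpace_fin] at hle
    rw [norm_smul, Real.norm_natCast]
    calc d * ‖∫ u, h u • u ∂(sphereUniform d)‖ ≤ d * (K * (1 / d)) := by gcongr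
      _ = K := by field_simp
      _ ≤ 2 * K := by linarith [hh.nonneg]
  have hmain := hinv.integral_modelChange_dirSum_le (ι := Fin N) hint hh
    (c := N / (N + 4.5 * d)) (by rw [hmoment, mul_one, finrank_euclideanSpace_fin]) hbias
    (by positivity)
    (by
      rw [hmoment, finrank_euclideanSpace_fin, Fintype.card_fin]
      field_simp
      linarith) a
  rw [hmoment, Fintype.card_fin] at hmain
  refine hmain.trans (add_le_add le_rfl ?_)
  simp only [chi, Omega₂_eq_mul_sq]
  have hslack : (72 * N + 216 * (d : ℝ) + d ^ 2) / (2 * d * (N + 4.5 * d)) * (d * (K ^ 2 / 12))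
      - (1 / 2 * (2 * K) ^ 2 + N / (N + 4.5 * d) / 4
        * ((d : ℝ) ^ 2 / N * ((K / 3) ^ 2 * 1) + (N - 1) / N * (2 * K) ^ 2))
      = (d ^ 2 / 72 + 1) * K ^ 2 / (N + 4.5 * d) := by
    field_simp
    ring
  rw [← sub_nonneg, hslack]
  positivity

variable [IsProbabilityMeasure τ] {m : Scheme}

lemma IsDirectionLaw.integral_modelChange_le (hd : 1 ≤ d) (hN : 1 ≤ N) (hτ : IsDirectionLaw m τ)
    (hh : IsDifferenceError (M * ν ^ 2 / 2) h) (a : Vec d) :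
    ∫ u, modelChange (stepFactor m d N) a (dirSum (scaling m d N) a h u) ∂τ
      ≤ -(1 / 4) * ‖a‖ ^ 2 + chi m d N M ν := by
  cases m with
  | cFD =>
    have hmain := integral_modelChange_le_of_cRS hd hN hτ.cRS_of_cFD hh a
    obtain ⟨rfl, -⟩ := hτ
    have hN0 : (N : ℝ) ≠ 0 := by positivity
    simpa only [div_self hN0, stepFactor, scaling, chi] using hmain
  | cRC => exact integral_modelChange_le_of_cRS hd hN (hτ.cRS_of_cRC hd) hh a
  | cRS => exact integral_modelChange_le_of_cRS hd hN hτ hh a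
  | cGS =>
    obtain rfl : τ = Measure.pi fun _ ↦ stdGaussian (Vec d) := hτ
    exact integral_modelChange_le_of_cGS hd hN hh a
  | cSS =>
    obtain rfl : τ = Measure.pi fun _ ↦ sphereUniform d := hτ
    exact integral_modelChange_le_of_cSS hd hN hh a

lemma IsDirectionLaw.integrable_norm_apply_pow (hd : 1 ≤ d) (hτ : IsDirectionLaw m τ) (j : Fin N)
    (k : ℕ) : Integrable (fun u ↦ ‖u j‖ ^ k) τ := by
  have hortho (hτ : IsDirectionLaw .cRS τ) : Integrable (fun u ↦ ‖u j‖ ^ k) τ := by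
    refine (integrable_const (1 : ℝ)).congr ?_
    filter_upwards [hτ.1] with u hu
    rw [hu.1 j, one_pow]
  have hpi {ρ : Measure (Vec d)} [IsProbabilityMeasure ρ] (hτ : τ = Measure.pi fun _ ↦ ρ)
      (hρ : Integrable (fun v ↦ ‖v‖ ^ k) ρ) : Integrable (fun u ↦ ‖u j‖ ^ k) τ := by
    subst hτ
    exact integrable_comp_eval (μ := fun _ ↦ ρ) hρ
  cases m with
  | cFD => exact hortho hτ.cRS_of_cFD
  | cRC => exact hortho (hτ.cRS_of_cRC hd)
  | cRS => exact hortho hτ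
  | cGS => exact hpi hτ (integrable_norm_pow_stdGaussian k)
  | cSS =>
    have := isProbabilityMeasure_sphereUniform hd
    exact hpi hτ (integrable_norm_pow_sphereUniform hd k)

end DirectionLaw

section CondLaw

variable {Ω X γ β E : Type*} [MeasurableSpace X] [MeasurableSpace γ] [MeasurableSpace β]

/-- The conditional law of the random variable `Z` given the σ-algebra `𝓗` is `κ (W ω)`, where the
parameter `W` is `𝓗`-measurable. Splitting the random law into a kernel and a parameter keeps `κ` a
kernel between fixed measurable spaces. -/
structure HasCondLaw (𝓗 : MeasurableSpace Ω) {mΩ : MeasurableSpace Ω} (W : Ω → γ) (κ : Kernel γ β)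
    (Z : Ω → β) (μ : Measure Ω) : Prop where
  le : 𝓗 ≤ mΩ
  measurable_param : Measurable[𝓗] W
  measurable : Measurable Z
  measure_inter_preimage : ∀ {B : Set Ω}, MeasurableSet[𝓗] B → ∀ {A : Set β}, MeasurableSet A →
    μ (B ∩ Z ⁻¹' A) = ∫⁻ ω in B, κ (W ω) A ∂μ

namespace HasCondLaw

variable {𝓗 mΩ : MeasurableSpace Ω} {W : Ω → γ} {κ : Kernel γ β} {Z : Ω → β} {μ : Measure Ω}

lemma of_indep (hle : 𝓗 ≤ mΩ) (hZ : Measurable Z)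
    (h : Indep (MeasurableSpace.comap Z inferInstance) 𝓗 μ) :
    HasCondLaw 𝓗 (fun _ ↦ ()) (Kernel.const Unit (μ.map Z)) Z μ where
  le := hle
  measurable_param := measurable_const
  measurable := hZ
  measure_inter_preimage {B} hB {A} hA := by
    rw [Set.inter_comm, (Indep_iff _ _ μ).1 h (Z ⁻¹' A) B ⟨A, hA, rfl⟩ hB]
    simp only [Kernel.const_apply, Measure.map_apply hZ hA, setLIntegral_const]

protected lemma restrict (h : HasCondLaw 𝓗 W κ Z μ) {B : Set Ω} (hB : MeasurableSet[𝓗] B) :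
    HasCondLaw 𝓗 W κ Z (μ.restrict B) where
  le := h.le
  measurable_param := h.measurable_param
  measurable := h.measurable
  measure_inter_preimage {B'} hB' {A} hA := by
    rw [Measure.restrict_apply ((h.le _ hB').inter (h.measurable hA)),
      Measure.restrict_restrict (h.le _ hB'), ← h.measure_inter_preimage (hB'.inter hB) hA,
      Set.inter_right_comm]

lemma map_prodMk [IsFiniteMeasure μ] [IsMarkovKernel κ] (h : HasCondLaw 𝓗 W κ Z μ)
    {Y : Ω → X} (hY : Measurable[𝓗] Y) :
    μ.map (fun ω ↦ ((Y ω, W ω), Z ω))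
      = μ.map (fun ω ↦ (Y ω, W ω)) ⊗ₘ κ.comap Prod.snd measurable_snd := by
  have hYW : Measurable[𝓗] fun ω ↦ (Y ω, W ω) := hY.prodMk h.measurable_param
  have hYWm : Measurable fun ω ↦ (Y ω, W ω) := hYW.mono h.le le_rfl
  refine Measure.ext_prod fun {s t} hs ht ↦ ?_
  rw [Measure.compProd_apply_prod hs ht, Measure.map_apply (hYWm.prodMk h.measurable) (hs.prod ht),
    setLIntegral_map hs (Kernel.measurable_coe _ ht) hYWm]
  exact h.measure_inter_preimage (hYW hs) ht

variable [NormedAddCommGroup E] {Y : Ω → X} {Φ : X × β → E}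

lemma integrable_prodMk_iff [IsFiniteMeasure μ] [IsMarkovKernel κ] (h : HasCondLaw 𝓗 W κ Z μ)
    (hY : Measurable[𝓗] Y) (hΦ : StronglyMeasurable Φ) :
    Integrable (fun ω ↦ Φ (Y ω, Z ω)) μ ↔
      (∀ᵐ ω ∂μ, Integrable (fun z ↦ Φ (Y ω, z)) (κ (W ω))) ∧
        Integrable (fun ω ↦ ∫ z, ‖Φ (Y ω, z)‖ ∂κ (W ω)) μ := by
  have hYW : Measurable fun ω ↦ (Y ω, W ω) := (hY.prodMk h.measurable_param).mono h.le le_rfl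
  have hΦ' : StronglyMeasurable fun p : (X × γ) × β ↦ Φ (p.1.1, p.2) :=
    hΦ.comp_measurable (by fun_prop)
  have hmap := integrable_map_measure (μ := μ) hΦ'.aestronglyMeasurable
    (hYW.prodMk h.measurable).aemeasurable
  rw [h.map_prodMk hY, Measure.integrable_compProd_iff hΦ'.aestronglyMeasurable,
    ae_map_iff hYW.aemeasurable (measurableSet_kernel_integrable hΦ'),
    integrable_map_measure hΦ'.norm.integral_kernel_prod_right'.aestronglyMeasurable
      hYW.aemeasurable] at hmap
  exact hmap.symm

variable [NormedSpace ℝ E]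

lemma stronglyMeasurable_integral [IsMarkovKernel κ] (h : HasCondLaw 𝓗 W κ Z μ)
    (hY : Measurable[𝓗] Y) (hΦ : StronglyMeasurable Φ) :
    StronglyMeasurable[𝓗] fun ω ↦ ∫ z, Φ (Y ω, z) ∂κ (W ω) := by
  have hΦ' : StronglyMeasurable fun p : (X × γ) × β ↦ Φ (p.1.1, p.2) :=
    hΦ.comp_measurable (by fun_prop)
  exact (hΦ'.integral_kernel_prod_right' (κ := κ.comap Prod.snd measurable_snd)).comp_measurable
    (hY.prodMk h.measurable_param)

lemma integrable_integral [IsFiniteMeasure μ] [IsMarkovKernel κ] (h : HasCondLaw 𝓗 W κ Z μ)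
    (hY : Measurable[𝓗] Y) (hΦ : StronglyMeasurable Φ)
    (hint : Integrable (fun ω ↦ Φ (Y ω, Z ω)) μ) :
    Integrable (fun ω ↦ ∫ z, Φ (Y ω, z) ∂κ (W ω)) μ :=
  ((h.integrable_prodMk_iff hY hΦ).1 hint).2.mono'
    ((h.stronglyMeasurable_integral hY hΦ).mono h.le).aestronglyMeasurable
    (.of_forall fun _ ↦ norm_integral_le_integral_norm _)

lemma integral_prodMk [IsFiniteMeasure μ] [IsMarkovKernel κ] (h : HasCondLaw 𝓗 W κ Z μ)
    (hY : Measurable[𝓗] Y) (hΦ : StronglyMeasurable Φ)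
    (hint : Integrable (fun ω ↦ Φ (Y ω, Z ω)) μ) :
    ∫ ω, Φ (Y ω, Z ω) ∂μ = ∫ ω, ∫ z, Φ (Y ω, z) ∂κ (W ω) ∂μ := by
  have hYW : Measurable fun ω ↦ (Y ω, W ω) := (hY.prodMk h.measurable_param).mono h.le le_rfl
  have hYWZ := (hYW.prodMk h.measurable).aemeasurable (μ := μ)
  have hΦ' : StronglyMeasurable fun p : (X × γ) × β ↦ Φ (p.1.1, p.2) :=
    hΦ.comp_measurable (by fun_prop)
  have hint' := (integrable_map_measure hΦ'.aestronglyMeasurable hYWZ).2 hint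
  have hmap := integral_map hYWZ hΦ'.aestronglyMeasurable
  rw [h.map_prodMk hY] at hint' hmap
  rw [← hmap, Measure.integral_compProd hint', integral_map hYW.aemeasurable
    hΦ'.integral_kernel_prod_right'.aestronglyMeasurable]
  rfl

theorem condExp_prodMk [CompleteSpace E] [IsFiniteMeasure μ] [IsMarkovKernel κ]
    (h : HasCondLaw 𝓗 W κ Z μ) (hY : Measurable[𝓗] Y) (hΦ : StronglyMeasurable Φ)
    (hint : Integrable (fun ω ↦ Φ (Y ω, Z ω)) μ) :
    μ[fun ω ↦ Φ (Y ω, Z ω) | 𝓗] =ᵐ[μ] fun ω ↦ ∫ z, Φ (Y ω, z) ∂κ (W ω) :=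
  (ae_eq_condExp_of_forall_setIntegral_eq h.le hint
    (fun _ _ _ ↦ (h.integrable_integral hY hΦ hint).integrableOn)
    (fun _ hB _ ↦ ((h.restrict hB).integral_prodMk hY hΦ hint.integrableOn).symm)
    (h.stronglyMeasurable_integral hY hΦ).aestronglyMeasurable).symm

end HasCondLaw

end CondLaw

section SampleMean

variable {Ξ E : Type*}

/-- The empirical mean of `v` over a sample. -/
noncomputable def sampleMean [AddCommGroup E] [Module ℝ E] (v : Ξ → E) (s : Sample Ξ) : E :=
  (1 / (s.1 : ℝ)) • ∑ i, v (s.2 i)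

lemma sampleMean_sq_nonneg (v : Ξ → ℝ) (s : Sample Ξ) : 0 ≤ sampleMean (fun ζ ↦ v ζ ^ 2) s :=
  smul_nonneg (by positivity) (Finset.sum_nonneg fun _ _ ↦ sq_nonneg _)

lemma norm_sampleMean_sq_le [NormedAddCommGroup E] [NormedSpace ℝ E] (v : Ξ → E) (s : Sample Ξ) :
    ‖sampleMean v s‖ ^ 2 ≤ sampleMean (fun ζ ↦ ‖v ζ‖ ^ 2) s := by
  obtain ⟨n, z⟩ := s
  obtain rfl | hn := eq_or_ne n 0
  · simp [sampleMean]
  have hn' : (n : ℝ) ≠ 0 := by exact_mod_cast hn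
  have hsum : ‖∑ i, v (z i)‖ ^ 2 ≤ n * ∑ i, ‖v (z i)‖ ^ 2 := by
    calc ‖∑ i, v (z i)‖ ^ 2 ≤ (∑ i, ‖v (z i)‖) ^ 2 := by
          gcongr
          exact norm_sum_le _ _
      _ ≤ n * ∑ i, ‖v (z i)‖ ^ 2 := by
          simpa using sq_sum_le_card_mul_sum_sq (s := Finset.univ) (f := fun i ↦ ‖v (z i)‖)
  calc ‖sampleMean v ⟨n, z⟩‖ ^ 2 = (1 / (n : ℝ)) ^ 2 * ‖∑ i, v (z i)‖ ^ 2 := by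
        rw [sampleMean, norm_smul, mul_pow, Real.norm_eq_abs, sq_abs]
    _ ≤ (1 / (n : ℝ)) ^ 2 * (n * ∑ i, ‖v (z i)‖ ^ 2) := by gcongr
    _ = 1 / (n : ℝ) * ∑ i, ‖v (z i)‖ ^ 2 := by field_simp

end SampleMean

section Sample

variable {X Ξ E : Type*} [MeasurableSpace X] [MeasurableSpace Ξ]

/-- The law of a sample of `n` independent draws from `P`, as a kernel in `n`. -/
noncomputable def sampleKernel (P : Measure Ξ) : Kernel ℕ (Sample Ξ) :=
  Kernel.ofFunOfCountable fun n ↦ (Measure.pi fun _ : Fin n ↦ P).map (Sigma.mk n)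

lemma measurableEmbedding_sigmaMk (n : ℕ) :
    MeasurableEmbedding (Sigma.mk (β := fun n ↦ Fin n → Ξ) n) where
  injective := sigma_mk_injective
  measurable := measurable_iff_le_map.2 (iInf_le _ n)
  measurableSet_image' {A} hA := MeasurableSpace.measurableSet_iInf.2 fun k ↦ by
    change MeasurableSet (Sigma.mk k ⁻¹' (Sigma.mk (β := fun n ↦ Fin n → Ξ) n '' A))
    obtain rfl | hk := eq_or_ne n k
    · rwa [Set.preimage_image_eq _ sigma_mk_injective]
    · rw [Set.preimage_image_sigmaMk_of_ne hk.symm]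
      exact .empty

instance (P : Measure Ξ) [IsProbabilityMeasure P] : IsMarkovKernel (sampleKernel P) :=
  ⟨fun n ↦ Measure.isProbabilityMeasure_map (measurableEmbedding_sigmaMk n).measurable.aemeasurable⟩

lemma integral_sampleKernel [NormedAddCommGroup E] [NormedSpace ℝ E] (P : Measure Ξ) (n : ℕ)
    (g : Sample Ξ → E) :
    ∫ s, g s ∂sampleKernel P n = ∫ z : Fin n → Ξ, g ⟨n, z⟩ ∂Measure.pi fun _ ↦ P :=
  (measurableEmbedding_sigmaMk n).integral_map g

lemma measurable_of_forall_size {α : Type*} [MeasurableSpace α] {g : X × Sample Ξ → α}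
    (hg : ∀ n, Measurable fun p : X × (Fin n → Ξ) ↦ g (p.1, ⟨n, p.2⟩)) : Measurable g := by
  intro A hA
  have hcover : g ⁻¹' A = ⋃ n, Prod.map id (Sigma.mk (β := fun n ↦ Fin n → Ξ) n) ''
      ((fun p : X × (Fin n → Ξ) ↦ g (p.1, ⟨n, p.2⟩)) ⁻¹' A) := by
    ext ⟨x, n, z⟩
    simp only [Set.mem_preimage, Set.mem_iUnion, Set.mem_image, Prod.exists, Prod.map_apply,
      Prod.mk.injEq, id]
    constructor
    · exact fun h ↦ ⟨n, x, z, h, rfl, rfl⟩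
    · rintro ⟨_, _, _, h, rfl, hs⟩
      cases hs
      exact h
  rw [hcover]
  exact .iUnion fun n ↦ (MeasurableEmbedding.id.prodMap
    (measurableEmbedding_sigmaMk n)).measurableSet_image' (hg n hA)

section Integral

variable [NormedAddCommGroup E] [NormedSpace ℝ E] {P : Measure Ξ} [IsProbabilityMeasure P]
  {v : Ξ → E}

lemma integrable_sampleMean (hv : Integrable v P) (n : ℕ) :
    Integrable (sampleMean v) (sampleKernel P n) :=
  (measurableEmbedding_sigmaMk n).integrable_map_iff.2 (Integrable.smul (1 / (n : ℝ))
    (integrable_finsetSum Finset.univ fun i _ ↦ integrable_comp_eval (μ := fun _ ↦ P) (i := i) hv))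

lemma integral_sampleMean (hv : Integrable v P) {n : ℕ} (hn : n ≠ 0) :
    ∫ s, sampleMean v s ∂sampleKernel P n = ∫ ζ, v ζ ∂P := by
  have hn' : (n : ℝ) ≠ 0 := by exact_mod_cast hn
  simp only [integral_sampleKernel, sampleMean]
  rw [integral_smul, integral_sum_comp_eval_pi hv, Fintype.card_fin, ← Nat.cast_smul_eq_nsmul ℝ,
    smul_smul, one_div_mul_cancel hn', one_smul]

end Integral

section SecondMoment

variable [NormedAddCommGroup E] [InnerProductSpace ℝ E] [CompleteSpace E] {P : Measure Ξ}
  [IsProbabilityMeasure P] {v : Ξ → E}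

lemma integral_norm_sub_integral_sq (hv : MemLp v 2 P) :
    ∫ ζ, ‖v ζ - ∫ ζ', v ζ' ∂P‖ ^ 2 ∂P = ∫ ζ, ‖v ζ‖ ^ 2 ∂P - ‖∫ ζ, v ζ ∂P‖ ^ 2 := by
  have hint := hv.integrable one_le_two
  set b := ∫ ζ, v ζ ∂P
  have hcross : Integrable (fun ζ ↦ 2 * inner ℝ b (v ζ)) P := (hint.const_inner b).const_mul 2
  simp only [norm_sub_sq_real, real_inner_comm b]
  rw [integral_add (by exact hv.integrable_norm_pow'.sub hcross) (integrable_const _),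
    integral_sub hv.integrable_norm_pow' hcross, integral_const_mul, integral_inner hint,
    real_inner_self_eq_norm_sq]
  simp only [integral_const, probReal_univ, one_smul]
  ring

variable [MeasurableSpace E] [BorelSpace E]

lemma integral_modelChange_sampleMean (hv : MemLp v 2 P) {n : ℕ} (hn : n ≠ 0) (c : ℝ) (a : E) :
    ∫ s, modelChange c a (sampleMean v s) ∂sampleKernel P n
      = modelChange c a (∫ ζ, v ζ ∂P)
        + c / 8 * ((∫ ζ, ‖v ζ - ∫ ζ', v ζ' ∂P‖ ^ 2 ∂P) / n) := by
  have hn' : (n : ℝ) ≠ 0 := by exact_mod_cast hn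
  have : NeZero n := ⟨hn⟩
  have hpi := integral_modelChange_mean_pi (ι := Fin n) hv 1 c a
  rw [Fintype.card_fin] at hpi
  rw [integral_sampleKernel, integral_norm_sub_integral_sq hv, modelChange]
  refine hpi.trans ?_
  simp only [one_smul]
  field_simp
  ring

end SecondMoment

variable [NormedAddCommGroup E] [MeasurableSpace E] [BorelSpace E] [SecondCountableTopology E]

lemma measurable_sampleMean [NormedSpace ℝ E] {w : X × Ξ → E} (hw : Measurable w) :
    Measurable fun p : X × Sample Ξ ↦ sampleMean (fun ζ ↦ w (p.1, ζ)) p.2 := by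
  refine measurable_of_forall_size fun n ↦ ?_
  have hsum : Measurable fun p : X × (Fin n → Ξ) ↦ ∑ i, w (p.1, p.2 i) :=
    Finset.measurable_sum _ fun i _ ↦ by fun_prop
  exact hsum.const_smul (1 / (n : ℝ))

namespace HasCondLaw

variable {Ω : Type*} {𝓗 mΩ : MeasurableSpace Ω} {μ : Measure Ω} [IsFiniteMeasure μ]
  {P : Measure Ξ} [IsProbabilityMeasure P]
  {size : Ω → ℕ} {S : Ω → Sample Ξ} {Y : Ω → X} {w : X × Ξ → E}

lemma memLp_sampleMean [NormedSpace ℝ E] (h : HasCondLaw 𝓗 size (sampleKernel P) S μ)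
    (hsize : ∀ ω, size ω ≠ 0) (hY : Measurable[𝓗] Y) (hw : Measurable w)
    (hw2 : ∀ x, MemLp (fun ζ ↦ w (x, ζ)) 2 P)
    (hint : Integrable (fun ω ↦ ∫ ζ, ‖w (Y ω, ζ)‖ ^ 2 ∂P) μ) :
    MemLp (fun ω ↦ sampleMean (fun ζ ↦ w (Y ω, ζ)) (S ω)) 2 μ := by
  have hYS : Measurable fun ω ↦ (Y ω, S ω) := (hY.mono h.le le_rfl).prodMk h.measurable
  have hmeas := (measurable_sampleMean hw).comp hYS
  have hmeas2 := measurable_sampleMean (hw.norm.pow_const 2)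
  have hsq (x : X) : Integrable (fun ζ ↦ ‖w (x, ζ)‖ ^ 2) P := (hw2 x).integrable_norm_pow'
  refine (memLp_two_iff_integrable_sq_norm hmeas.aestronglyMeasurable).2 ?_
  have hdom : Integrable (fun ω ↦ sampleMean (fun ζ ↦ ‖w (Y ω, ζ)‖ ^ 2) (S ω)) μ := by
    refine (h.integrable_prodMk_iff (Φ := fun p ↦ sampleMean (fun ζ ↦ ‖w (p.1, ζ)‖ ^ 2) p.2) hY
      hmeas2.stronglyMeasurable).2
      ⟨.of_forall fun ω ↦ integrable_sampleMean (hsq _) _, hint.congr (.of_forall fun ω ↦ ?_)⟩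
    simp only [Real.norm_of_nonneg (sampleMean_sq_nonneg _ _),
      integral_sampleMean (hsq _) (hsize ω)]
  refine hdom.mono' (hmeas.norm.pow_const 2).aestronglyMeasurable (.of_forall fun ω ↦ ?_)
  rw [Real.norm_of_nonneg (by positivity)]
  exact norm_sampleMean_sq_le (fun ζ ↦ w (Y ω, ζ)) (S ω)

lemma condExp_sampleMean [NormedSpace ℝ E] [CompleteSpace E]
    (h : HasCondLaw 𝓗 size (sampleKernel P) S μ) (hsize : ∀ ω, size ω ≠ 0)
    (hY : Measurable[𝓗] Y) (hw : Measurable w) (hw2 : ∀ x, MemLp (fun ζ ↦ w (x, ζ)) 2 P)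
    (hint : Integrable (fun ω ↦ ∫ ζ, ‖w (Y ω, ζ)‖ ^ 2 ∂P) μ) :
    μ[fun ω ↦ sampleMean (fun ζ ↦ w (Y ω, ζ)) (S ω) | 𝓗] =ᵐ[μ] fun ω ↦ ∫ ζ, w (Y ω, ζ) ∂P := by
  refine (h.condExp_prodMk hY (Φ := fun p ↦ sampleMean (fun ζ ↦ w (p.1, ζ)) p.2)
    (measurable_sampleMean hw).stronglyMeasurable
    ((h.memLp_sampleMean hsize hY hw hw2 hint).integrable one_le_two)).trans (.of_forall fun ω ↦ ?_)
  exact integral_sampleMean ((hw2 _).integrable one_le_two) (hsize ω)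

lemma condExp_modelChange_sampleMean [InnerProductSpace ℝ E] [CompleteSpace E]
    (h : HasCondLaw 𝓗 size (sampleKernel P) S μ)
    (hsize : ∀ ω, size ω ≠ 0) (hY : Measurable[𝓗] Y) (hw : Measurable w)
    (hw2 : ∀ x, MemLp (fun ζ ↦ w (x, ζ)) 2 P)
    (hint : Integrable (fun ω ↦ ∫ ζ, ‖w (Y ω, ζ)‖ ^ 2 ∂P) μ) (c : ℝ) {a : X → E}
    (ha : Measurable a) (ha2 : MemLp (fun ω ↦ a (Y ω)) 2 μ) :
    μ[fun ω ↦ modelChange c (a (Y ω)) (sampleMean (fun ζ ↦ w (Y ω, ζ)) (S ω)) | 𝓗]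
      =ᵐ[μ] fun ω ↦ modelChange c (a (Y ω)) (∫ ζ, w (Y ω, ζ) ∂P)
        + c / 8 * ((∫ ζ, ‖w (Y ω, ζ) - ∫ ζ', w (Y ω, ζ') ∂P‖ ^ 2 ∂P) / size ω) := by
  have hmean := h.memLp_sampleMean hsize hY hw hw2 hint
  have hΦ : Measurable fun p : X × Sample Ξ ↦
      modelChange c (a p.1) (sampleMean (fun ζ ↦ w (p.1, ζ)) p.2) := by
    have := measurable_sampleMean hw
    unfold modelChange
    fun_prop
  refine (h.condExp_prodMk hY hΦ.stronglyMeasurable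
    ((integrable_inner_of_memLp_two ha2 hmean).neg.add
      (hmean.integrable_norm_pow'.const_mul _))).trans (.of_forall fun ω ↦ ?_)
  exact integral_modelChange_sampleMean (hw2 (Y ω)) (hsize ω) c (a (Y ω))

end HasCondLaw

end Sample

lemma measurable_prodMk_directions {d : ℕ} {Ω Ξ E : Type*} [MeasurableSpace Ξ] [MeasurableSpace E]
    {N : ℕ → ℕ} {T : (k : ℕ) → Ω → Fin (N k) → Vec d} {S : ℕ → Ω → Sample Ξ} {k : ℕ} {X : Ω → E}
    (hX : Measurable[past T S k] X) : Measurable[pastHalf T S k] fun ω ↦ (X ω, T k ω) :=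
  (hX.mono le_sup_left le_rfl).prodMk (measurable_iff_comap_le.2 le_sup_right)

namespace Sampling

variable {d : ℕ} {Ω Ξ : Type*} [mΩ : MeasurableSpace Ω] [MeasurableSpace Ξ] {N : ℕ → ℕ}
  {μ : Measure Ω} {P : Measure Ξ} {m : Scheme} {T : (k : ℕ) → Ω → Fin (N k) → Vec d}
  {S : ℕ → Ω → Sample Ξ}

lemma past_le (h : Sampling μ P m T S) (k : ℕ) : past T S k ≤ mΩ :=
  iSup_le fun j ↦ sup_le (h.measurable_T j).comap_le (h.measurable_S j).comap_le

lemma pastHalf_le (h : Sampling μ P m T S) (k : ℕ) : pastHalf T S k ≤ mΩ :=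
  sup_le (h.past_le k) (h.measurable_T k).comap_le

lemma size_ne_zero (h : Sampling μ P m T S) (k : ℕ) (ω : Ω) : (S k ω).1 ≠ 0 :=
  Nat.one_le_iff_ne_zero.1 (h.size_pos k ω)

lemma measurable_inv_size (h : Sampling μ P m T S) (k : ℕ) :
    Measurable[past T S k] fun ω ↦ ((S k ω).1 : ℝ)⁻¹ :=
  (measurable_from_nat (f := fun n : ℕ ↦ (n : ℝ)⁻¹)).comp (h.size_past k)

lemma hasCondLaw_directions (h : Sampling μ P m T S) (k : ℕ) :
    HasCondLaw (past T S k) (fun _ ↦ ()) (Kernel.const Unit (μ.map (T k))) (T k) μ :=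
  .of_indep (h.past_le k) (h.measurable_T k) (h.indep_T k)

lemma measure_inter_size_eq (h : Sampling μ P m T S) (k n : ℕ) {B : Set Ω}
    (hB : MeasurableSet[pastHalf T S k] B) {A : Set (Sample Ξ)} (hA : MeasurableSet A) :
    μ (B ∩ S k ⁻¹' A ∩ (fun ω ↦ (S k ω).1) ⁻¹' {n})
      = sampleKernel P n A * μ (B ∩ (fun ω ↦ (S k ω).1) ⁻¹' {n}) := by
  have hmk := (measurableEmbedding_sigmaMk (Ξ := Ξ) n).measurable
  have hset : B ∩ S k ⁻¹' A ∩ (fun ω ↦ (S k ω).1) ⁻¹' {n}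
      = B ∩ {ω | ∃ z ∈ Sigma.mk n ⁻¹' A, S k ω = ⟨n, z⟩} := by
    ext ω
    simp only [Set.mem_inter_iff, Set.mem_preimage, Set.mem_singleton_iff, Set.mem_ofPred_eq,
      and_assoc, and_congr_right_iff]
    intro _
    constructor
    · rintro ⟨hA, rfl⟩
      exact ⟨(S k ω).2, hA, rfl⟩
    · rintro ⟨z, hz, hS⟩
      rw [hS]
      exact ⟨hz, rfl⟩
  rw [hset, h.iid_S k n B hB _ (hmk hA), mul_comm]
  congr 1
  exact (Measure.map_apply hmk hA).symm

lemma hasCondLaw_sample (h : Sampling μ P m T S) (k : ℕ) :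
    HasCondLaw (pastHalf T S k) (fun ω ↦ (S k ω).1) (sampleKernel P) (S k) μ where
  le := h.pastHalf_le k
  measurable_param := (h.size_past k).mono le_sup_left le_rfl
  measurable := h.measurable_S k
  measure_inter_preimage {B} hB {A} hA := by
    have hsize : Measurable fun ω ↦ (S k ω).1 := (h.size_past k).mono (h.past_le k) le_rfl
    have hsplit (C : Set Ω) : ∑' n, μ (C ∩ (fun ω ↦ (S k ω).1) ⁻¹' {n}) = μ C := by
      simp only [Set.inter_comm C, ← Measure.restrict_apply (hsize (measurableSet_singleton _))]
      rw [← measure_iUnion (fun i j hij ↦ (Set.disjoint_singleton.2 hij).preimage _)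
        fun n ↦ hsize (measurableSet_singleton n), ← Set.preimage_iUnion, Set.iUnion_of_singleton,
        Set.preimage_univ, Measure.restrict_apply_univ]
    rw [← hsplit, ← lintegral_map (f := fun n ↦ sampleKernel P n A) (measurable_of_countable _)
      hsize, lintegral_countable']
    refine tsum_congr fun n ↦ ?_
    rw [h.measure_inter_size_eq k n hB hA, Measure.map_apply hsize (measurableSet_singleton n),
      Measure.restrict_apply (hsize (measurableSet_singleton n)), Set.inter_comm]

end Sampling

section Estimator

variable {d n : ℕ} {ν L : ℝ} {φ : Vec d → ℝ}

lemma gradEst_eq_dirSum (φ : Vec d → ℝ) (ν γ : ℝ) (u : Fin n → Vec d) (x : Vec d) :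
    gradEst φ ν γ u x = dirSum γ (gradient φ x) (diffErr φ ν x) u := by
  simp [gradEst, dirSum, dirTerm, diffErr]

lemma HessLipschitz.isDifferenceError_diffErr {M : ℝ} (hd : 1 ≤ d) (hφ : ContDiff ℝ 2 φ)
    (h : HessLipschitz φ M) (hν : ν ≠ 0) (x : Vec d) :
    IsDifferenceError (M * ν ^ 2 / 2) (diffErr φ ν x) where
  nonneg := by
    have := h.nonneg hd
    positivity
  continuous := continuous_diffErr hφ.continuous ν x
  abs_le u := (h.abs_diffErr_le hφ hν x u).trans_eq (by ring)
  abs_sub_le _ _ hu := h.abs_diffErr_sub_le hφ (h.nonneg hd) hν x hu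

lemma measurable_gradEst {Z : Type*} [MeasurableSpace Z] {g : Vec d → Z → ℝ}
    (hc : ∀ z, Continuous fun x ↦ g x z) (hm : ∀ x, Measurable (g x)) (ν γ : ℝ) :
    Measurable fun p : (Vec d × (Fin n → Vec d)) × Z ↦
      gradEst (fun y ↦ g y p.2) ν γ p.1.2 p.1.1 := by
  have hg : Measurable (Function.uncurry g) := measurable_uncurry_of_continuous_of_measurable hc hm
  have heval (s : ℝ) (j : Fin n) : Measurable fun p : (Vec d × (Fin n → Vec d)) × Z ↦
      g (p.1.1 + s • p.1.2 j) p.2 :=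
    hg.comp (f := fun p : (Vec d × (Fin n → Vec d)) × Z ↦ (p.1.1 + s • p.1.2 j, p.2))
      (by fun_prop)
  unfold gradEst
  refine (Finset.measurable_sum _ fun j _ ↦ ?_).const_smul γ
  have hdiff := (heval ν j).sub (heval (-ν) j)
  simp only [neg_smul, ← sub_eq_add_neg] at hdiff
  exact (hdiff.div_const _).smul (by fun_prop)

lemma measurable_gradEst_apply (hc : Continuous φ) (ν γ : ℝ) :
    Measurable fun p : Vec d × (Fin n → Vec d) ↦ gradEst φ ν γ p.2 p.1 :=
  (measurable_gradEst (Z := Unit) (g := fun x _ ↦ φ x) (fun _ ↦ hc) (fun _ ↦ measurable_const)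
    ν γ).comp (g := fun p : (Vec d × (Fin n → Vec d)) × Unit ↦ gradEst φ ν γ p.1.2 p.1.1)
    (f := fun p : Vec d × (Fin n → Vec d) ↦ (p, ())) (by fun_prop)

lemma gradEst_subsampled {Ξ : Type*} (f : Vec d → Ξ → ℝ) (ν γ : ℝ) (u : Fin n → Vec d)
    (x : Vec d) (s : Sample Ξ) :
    gradEst (subsampled f s) ν γ u x = sampleMean (fun ζ ↦ gradEst (fun y ↦ f y ζ) ν γ u x) s := by
  simp only [gradEst, subsampled, sampleMean, Finset.smul_sum, smul_smul]
  rw [Finset.sum_comm]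
  refine Finset.sum_congr rfl fun j _ ↦ ?_
  rw [← Finset.sum_smul]
  congr 1
  simp only [← Finset.mul_sum, ← Finset.sum_div, Finset.sum_sub_distrib]
  ring

/-- The dependence on the directions `u` of a bound for the size of the estimator. -/
noncomputable def dirSize (u : Fin n → Vec d) : ℝ := ∑ j, (‖u j‖ ^ 2 + ‖u j‖ ^ 3)

lemma measurable_dirSize : Measurable (dirSize : (Fin n → Vec d) → ℝ) := by
  unfold dirSize
  fun_prop

lemma IsDirectionLaw.memLp_dirSize {m : Scheme} {τ : Measure (Fin n → Vec d)}
    [IsProbabilityMeasure τ] (hd : 1 ≤ d) (hτ : IsDirectionLaw m τ) : MemLp dirSize 2 τ := by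
  have hpow (j : Fin n) (k : ℕ) : MemLp (fun u : Fin n → Vec d ↦ ‖u j‖ ^ k) 2 τ := by
    refine (memLp_two_iff_integrable_sq (by fun_prop : Measurable _).aestronglyMeasurable).2 ?_
    simp only [← pow_mul]
    exact hτ.integrable_norm_apply_pow hd j (k * 2)
  exact memLp_finsetSum _ fun j _ ↦ (hpow j 2).add (hpow j 3)

lemma GradLipschitz.norm_gradEst_le (hφ : ContDiff ℝ 2 φ) (hL : 0 ≤ L) (h : GradLipschitz φ L)
    (hν : 0 < ν) (γ : ℝ) (u : Fin n → Vec d) (x : Vec d) :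
    ‖gradEst φ ν γ u x‖
      ≤ |γ| * (‖gradient φ 0‖ + L + L * ν) * ((1 + ‖x‖) * dirSize u) := by
  have hx := h.norm_gradient_le 0 x
  rw [sub_zero] at hx
  rw [gradEst, norm_smul, Real.norm_eq_abs, mul_assoc, dirSize, Finset.mul_sum, Finset.mul_sum]
  gcongr
  refine (norm_sum_le _ _).trans (Finset.sum_le_sum fun j _ ↦ ?_)
  rw [norm_smul, Real.norm_eq_abs]
  have hscale : ‖gradient φ x‖ + L * ν ≤ (‖gradient φ 0‖ + L + L * ν) * (1 + ‖x‖) := by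
    have : 0 ≤ (‖gradient φ 0‖ + L * ν) * ‖x‖ := by positivity
    linarith
  calc _ ≤ (‖gradient φ x‖ + L * ν * ‖u j‖) * ‖u j‖ * ‖u j‖ := by
        gcongr
        exact h.abs_centralDiff_le hφ hL hν x (u j)
    _ ≤ (‖gradient φ x‖ + L * ν) * (‖u j‖ ^ 2 + ‖u j‖ ^ 3) := by
        have : 0 ≤ ‖gradient φ x‖ * ‖u j‖ ^ 3 + L * ν * ‖u j‖ ^ 2 := by positivity
        linarith
    _ ≤ (‖gradient φ 0‖ + L + L * ν) * (1 + ‖x‖) * (‖u j‖ ^ 2 + ‖u j‖ ^ 3) := by gcongr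
    _ = _ := by ring

variable {Ξ : Type*} [MeasurableSpace Ξ] {P : Measure Ξ} {f : Vec d → Ξ → ℝ} {Lf Mf : ℝ}

lemma WellPosed.integral_gradEst (hf : WellPosed P f) (ν γ : ℝ) (u : Fin n → Vec d) (x : Vec d) :
    ∫ ζ, gradEst (fun y ↦ f y ζ) ν γ u x ∂P = gradEst (objective P f) ν γ u x := by
  have hint (j : Fin n) :
      Integrable (fun ζ ↦ (f (x + ν • u j) ζ - f (x - ν • u j) ζ) / (2 * ν)) P :=
    ((hf.integrable _).sub (hf.integrable _)).div_const _
  simp only [gradEst, objective]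
  rw [integral_smul, integral_finsetSum _ fun j _ ↦ (hint j).smul_const _]
  simp only [integral_smul_const, integral_div, integral_sub (hf.integrable _) (hf.integrable _)]

/-- The variance of the estimator with a single sample, for fixed directions. -/
noncomputable def estVar (P : Measure Ξ) (f : Vec d → Ξ → ℝ) (ν γ : ℝ) (u : Fin n → Vec d)
    (x : Vec d) : ℝ :=
  ∫ ζ, ‖gradEst (fun y ↦ f y ζ) ν γ u x - gradEst (objective P f) ν γ u x‖ ^ 2 ∂P

lemma estVar_nonneg (ν γ : ℝ) (u : Fin n → Vec d) (x : Vec d) : 0 ≤ estVar P f ν γ u x :=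
  integral_nonneg fun _ ↦ by positivity

namespace RegularLoss

lemma measurable_gradEst (hf : RegularLoss P f Lf Mf) (ν γ : ℝ) :
    Measurable fun p : (Vec d × (Fin n → Vec d)) × Ξ ↦
      gradEst (fun y ↦ f y p.2) ν γ p.1.2 p.1.1 :=
  CFD.measurable_gradEst hf.continuous hf.measurable ν γ

variable [IsProbabilityMeasure P]

lemma exists_memLp_norm_gradEst_le (hd : 1 ≤ d) (hf : RegularLoss P f Lf Mf) (hν : 0 < ν) (γ : ℝ) :
    ∃ C : Ξ → ℝ, MemLp C 2 P ∧ ∀ (u : Fin n → Vec d) x ζ,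
      ‖gradEst (fun y ↦ f y ζ) ν γ u x‖ ≤ C ζ * ((1 + ‖x‖) * dirSize u) := by
  have hL := hf.gradLipschitz_nonneg hd
  have hdev : MemLp (fun ζ ↦ ‖gradient (fun y ↦ f y ζ) 0 - gradient (objective P f) 0‖) 2 P := by
    refine (memLp_two_iff_integrable_sq ?_).2 hf.integrable_norm_gradient_sub_sq
    refine hf.integrable_norm_gradient_sub_sq.aemeasurable.sqrt.aestronglyMeasurable.congr ?_
    exact .of_forall fun ζ ↦ Real.sqrt_sq (norm_nonneg _)
  refine ⟨_, (hdev.add (memLp_const (‖gradient (objective P f) 0‖ + Lf + Lf * ν))).const_mul |γ|,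
    fun u x ζ ↦ ((hf.gradLipschitz ζ).norm_gradEst_le (hf.contDiff ζ) hL hν γ u x).trans ?_⟩
  have hw : 0 ≤ dirSize u := Finset.sum_nonneg fun _ _ ↦ by positivity
  have htri := norm_le_norm_sub_add (gradient (fun y ↦ f y ζ) 0) (gradient (objective P f) 0)
  simp only [Pi.add_apply]
  gcongr _ * ?_ * _
  linarith

lemma memLp_gradEst (hd : 1 ≤ d) (hf : RegularLoss P f Lf Mf) (hν : 0 < ν) (γ : ℝ)
    (u : Fin n → Vec d) (x : Vec d) : MemLp (fun ζ ↦ gradEst (fun y ↦ f y ζ) ν γ u x) 2 P := by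
  obtain ⟨C, hC, hle⟩ := hf.exists_memLp_norm_gradEst_le (n := n) hd hν γ
  have hmeas : Measurable fun ζ ↦ gradEst (fun y ↦ f y ζ) ν γ u x :=
    (hf.measurable_gradEst ν γ).comp (f := fun ζ ↦ ((x, u), ζ)) (by fun_prop)
  exact (hC.mul_const ((1 + ‖x‖) * dirSize u)).mono' hmeas.aestronglyMeasurable
    (.of_forall (hle u x))

lemma exists_integral_norm_gradEst_sq_le (hd : 1 ≤ d) (hf : RegularLoss P f Lf Mf) (hν : 0 < ν)
    (γ : ℝ) : ∃ C : ℝ, ∀ (u : Fin n → Vec d) x,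
      ∫ ζ, ‖gradEst (fun y ↦ f y ζ) ν γ u x‖ ^ 2 ∂P ≤ C * ((1 + ‖x‖) * dirSize u) ^ 2 := by
  obtain ⟨C, hC, hle⟩ := hf.exists_memLp_norm_gradEst_le (n := n) hd hν γ
  refine ⟨∫ ζ, C ζ ^ 2 ∂P, fun u x ↦ ?_⟩
  rw [← integral_mul_const]
  refine integral_mono (hf.memLp_gradEst hd hν γ u x).integrable_norm_pow'
    (hC.integrable_sq.mul_const _) fun ζ ↦ ?_
  calc ‖gradEst (fun y ↦ f y ζ) ν γ u x‖ ^ 2 ≤ (C ζ * ((1 + ‖x‖) * dirSize u)) ^ 2 := by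
        gcongr
        exact hle u x ζ
    _ = C ζ ^ 2 * ((1 + ‖x‖) * dirSize u) ^ 2 := by ring

lemma estVar_eq (hd : 1 ≤ d) (hf : RegularLoss P f Lf Mf) (hν : 0 < ν) (γ : ℝ)
    (u : Fin n → Vec d) (x : Vec d) :
    estVar P f ν γ u x
      = ∫ ζ, ‖gradEst (fun y ↦ f y ζ) ν γ u x‖ ^ 2 ∂P - ‖gradEst (objective P f) ν γ u x‖ ^ 2 := by
  rw [estVar, ← hf.integral_gradEst]
  exact integral_norm_sub_integral_sq (hf.memLp_gradEst hd hν γ u x)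

end RegularLoss

end Estimator

attribute [local irreducible] gradEst

section Descent

variable {d : ℕ} {Ω Ξ : Type*} [mΩ : MeasurableSpace Ω] [MeasurableSpace Ξ] {N : ℕ → ℕ}
  {μ : Measure Ω} [IsProbabilityMeasure μ] {P : Measure Ξ} [IsProbabilityMeasure P] {m : Scheme}
  {T : (k : ℕ) → Ω → Fin (N k) → Vec d} {S : ℕ → Ω → Sample Ξ} {f : Vec d → Ξ → ℝ}
  {Lf Mf ν θ : ℝ} {k : ℕ} {X : Ω → Vec d}

lemma GradLipschitz.memLp_gradient_comp {φ : Vec d → ℝ} {L : ℝ} (hφ : ContDiff ℝ 2 φ)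
    (h : GradLipschitz φ L) (hX : MemLp X 2 μ) : MemLp (fun ω ↦ gradient φ (X ω)) 2 μ := by
  have hcont : Continuous (gradient φ) := (contDiff_gradient hφ).continuous
  refine ((memLp_const ‖gradient φ 0‖).add (hX.norm.const_mul L)).mono'
    (hcont.comp_aestronglyMeasurable hX.1) (.of_forall fun ω ↦ ?_)
  simpa using h.norm_gradient_le 0 (X ω)

lemma GradLipschitz.integrable_comp {φ : Vec d → ℝ} {L : ℝ} (hφ : ContDiff ℝ 2 φ)
    (h : GradLipschitz φ L) (hX : MemLp X 2 μ) : Integrable (fun ω ↦ φ (X ω)) μ := by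
  have hlin : Integrable (fun ω ↦ inner ℝ (gradient φ 0) (X ω)) μ :=
    (hX.integrable one_le_two).const_inner _
  have hquad : Integrable (fun ω ↦ φ (X ω) - φ 0 - inner ℝ (gradient φ 0) (X ω)) μ := by
    refine (hX.integrable_norm_pow'.const_mul (L / 2)).mono'
      (((hφ.continuous.comp_aestronglyMeasurable hX.1).sub aestronglyMeasurable_const).sub hlin.1)
      (.of_forall fun ω ↦ ?_)
    simpa using h.abs_sub_sub_inner_le hφ 0 (X ω)
  refine ((hquad.add hlin).add (integrable_const (φ 0))).congr (.of_forall fun ω ↦ ?_)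
  simp only [Pi.add_apply, sub_add_cancel]

lemma GradLipschitz.apply_sub_smul_le {φ : Vec d → ℝ} {L : ℝ} (hφ : ContDiff ℝ 2 φ)
    (h : GradLipschitz φ L) (x g : Vec d) (a : ℝ) :
    φ (x - a • g) ≤ φ x + a * modelChange (4 * L * a) (gradient φ x) g := by
  have htaylor := (abs_le.1 (h.abs_sub_sub_inner_le hφ x (-(a • g)))).2
  rw [norm_neg, norm_smul, mul_pow, Real.norm_eq_abs, sq_abs, inner_neg_right,
    inner_smul_right, ← sub_eq_add_neg] at htaylor
  rw [modelChange]
  linarith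

namespace Sampling

omit [IsProbabilityMeasure P] in
lemma memLp_one_add_norm_mul_dirSize (hd : 1 ≤ d) (h : Sampling μ P m T S)
    (hX : Measurable[past T S k] X) (hX2 : MemLp X 2 μ) :
    MemLp (fun ω ↦ (1 + ‖X ω‖) * dirSize (T k ω)) 2 μ := by
  have hT := h.measurable_T k
  have := Measure.isProbabilityMeasure_map (μ := μ) hT.aemeasurable
  have hsize : MemLp (fun ω ↦ dirSize (T k ω)) 2 μ :=
    ((h.law_T k).memLp_dirSize hd).comp_measurePreserving (hT.measurePreserving μ)
  have hnorm : MemLp (fun ω ↦ 1 + ‖X ω‖) 2 μ := (memLp_const (1 : ℝ)).add hX2.norm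
  have hindep : IndepFun X (T k) μ :=
    (indep_of_indep_of_le_right (h.indep_T k) (measurable_iff_comap_le.1 hX)).symm
  have hindep' : IndepFun (fun ω ↦ 1 + ‖X ω‖) (fun ω ↦ dirSize (T k ω)) μ :=
    hindep.comp (φ := fun x ↦ 1 + ‖x‖) (by fun_prop) measurable_dirSize
  exact memLp_two_mul_of_indepFun hindep' hnorm hsize

lemma memLp_gradEst_objective (hd : 1 ≤ d) (h : Sampling μ P m T S) (hf : RegularLoss P f Lf Mf)
    (hν : 0 < ν) (hX : Measurable[past T S k] X) (hX2 : MemLp X 2 μ) (γ : ℝ) :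
    MemLp (fun ω ↦ gradEst (objective P f) ν γ (T k ω) (X ω)) 2 μ := by
  have hmeas : Measurable fun ω ↦ gradEst (objective P f) ν γ (T k ω) (X ω) :=
    (measurable_gradEst_apply hf.continuous_objective ν γ).comp
      ((hX.mono (h.past_le k) le_rfl).prodMk (h.measurable_T k))
  exact ((h.memLp_one_add_norm_mul_dirSize hd hX hX2).const_mul _).mono' hmeas.aestronglyMeasurable
    (.of_forall fun ω ↦ (hf.gradLipschitz_objective hd).norm_gradEst_le hf.contDiff_objective
      (hf.gradLipschitz_nonneg hd) hν γ _ _)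

lemma integrable_integral_norm_gradEst_sq (hd : 1 ≤ d) (h : Sampling μ P m T S)
    (hf : RegularLoss P f Lf Mf) (hν : 0 < ν) (hX : Measurable[past T S k] X) (hX2 : MemLp X 2 μ)
    (γ : ℝ) :
    Integrable (fun ω ↦ ∫ ζ, ‖gradEst (fun y ↦ f y ζ) ν γ (T k ω) (X ω)‖ ^ 2 ∂P) μ := by
  obtain ⟨C, hC⟩ := hf.exists_integral_norm_gradEst_sq_le (n := N k) hd hν γ
  have hmeas := ((hf.measurable_gradEst (n := N k) ν γ).norm.pow_const 2).stronglyMeasurable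
    |>.integral_prod_right' (ν := P)
  refine ((h.memLp_one_add_norm_mul_dirSize hd hX hX2).integrable_sq.const_mul C).mono'
    (hmeas.comp_measurable
      ((hX.mono (h.past_le k) le_rfl).prodMk (h.measurable_T k))).aestronglyMeasurable
    (.of_forall fun ω ↦ ?_)
  rw [Real.norm_of_nonneg (integral_nonneg fun _ ↦ by positivity)]
  exact hC _ _

lemma integrable_estVar (hd : 1 ≤ d) (h : Sampling μ P m T S) (hf : RegularLoss P f Lf Mf)
    (hν : 0 < ν) (hX : Measurable[past T S k] X) (hX2 : MemLp X 2 μ) (γ : ℝ) :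
    Integrable (fun ω ↦ estVar P f ν γ (T k ω) (X ω)) μ := by
  simp only [hf.estVar_eq hd hν γ]
  exact (h.integrable_integral_norm_gradEst_sq hd hf hν hX hX2 γ).sub
    (h.memLp_gradEst_objective hd hf hν hX hX2 γ).integrable_norm_pow'

lemma integrable_estVar_div (hd : 1 ≤ d) (h : Sampling μ P m T S) (hf : RegularLoss P f Lf Mf)
    (hν : 0 < ν) (hX : Measurable[past T S k] X) (hX2 : MemLp X 2 μ) (γ : ℝ) :
    Integrable (fun ω ↦ estVar P f ν γ (T k ω) (X ω) / ((S k ω).1 : ℝ)) μ := by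
  have hvar := h.integrable_estVar hd hf hν hX hX2 γ
  have hinv := (h.measurable_inv_size k).mono (h.past_le k) le_rfl
  simp only [div_eq_mul_inv]
  refine hvar.mono' (hvar.1.mul hinv.aestronglyMeasurable) (.of_forall fun ω ↦ ?_)
  have hnn := estVar_nonneg (P := P) (f := f) ν γ (T k ω) (X ω)
  rw [Real.norm_of_nonneg (by positivity)]
  exact mul_le_of_le_one_right hnn (inv_le_one_of_one_le₀ (by exact_mod_cast h.size_pos k ω))

lemma memLp_gradEst_subsampled (hd : 1 ≤ d) (h : Sampling μ P m T S) (hf : RegularLoss P f Lf Mf)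
    (hν : 0 < ν) (hX : Measurable[past T S k] X) (hX2 : MemLp X 2 μ) (γ : ℝ) :
    MemLp (fun ω ↦ gradEst (subsampled f (S k ω)) ν γ (T k ω) (X ω)) 2 μ := by
  simp only [gradEst_subsampled]
  have hlaw := h.hasCondLaw_sample k
  have hmean := hlaw.memLp_sampleMean (h.size_ne_zero k) (measurable_prodMk_directions hX)
    (hf.measurable_gradEst ν γ) (fun p ↦ hf.memLp_gradEst hd hν γ p.2 p.1)
    (h.integrable_integral_norm_gradEst_sq hd hf hν hX hX2 γ)
  exact hmean

lemma condExp_gradEst_subsampled (hd : 1 ≤ d) (h : Sampling μ P m T S)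
    (hf : RegularLoss P f Lf Mf) (hν : 0 < ν) (hX : Measurable[past T S k] X) (hX2 : MemLp X 2 μ)
    (γ : ℝ) :
    μ[fun ω ↦ gradEst (subsampled f (S k ω)) ν γ (T k ω) (X ω) | pastHalf T S k]
      =ᵐ[μ] fun ω ↦ gradEst (objective P f) ν γ (T k ω) (X ω) := by
  simp only [gradEst_subsampled, ← hf.integral_gradEst]
  have hlaw := h.hasCondLaw_sample k
  have hmean := hlaw.condExp_sampleMean (h.size_ne_zero k) (measurable_prodMk_directions hX)
    (hf.measurable_gradEst ν γ) (fun p ↦ hf.memLp_gradEst hd hν γ p.2 p.1)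
    (h.integrable_integral_norm_gradEst_sq hd hf hν hX hX2 γ)
  exact hmean

lemma condExp_modelChange_gradEst_subsampled (hd : 1 ≤ d) (h : Sampling μ P m T S)
    (hf : RegularLoss P f Lf Mf) (hν : 0 < ν) (hX : Measurable[past T S k] X) (hX2 : MemLp X 2 μ)
    (γ c : ℝ) :
    μ[fun ω ↦ modelChange c (gradient (objective P f) (X ω))
        (gradEst (subsampled f (S k ω)) ν γ (T k ω) (X ω)) | pastHalf T S k]
      =ᵐ[μ] fun ω ↦ modelChange c (gradient (objective P f) (X ω))
          (gradEst (objective P f) ν γ (T k ω) (X ω))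
        + c / 8 * (estVar P f ν γ (T k ω) (X ω) / ((S k ω).1 : ℝ)) := by
  have hgrad : Measurable fun p : Vec d × (Fin (N k) → Vec d) ↦ gradient (objective P f) p.1 :=
    (contDiff_gradient hf.contDiff_objective).continuous.measurable.comp measurable_fst
  have hgradX := (hf.gradLipschitz_objective hd).memLp_gradient_comp hf.contDiff_objective hX2
  simp only [gradEst_subsampled, estVar, ← hf.integral_gradEst]
  have hlaw := h.hasCondLaw_sample k
  have hmean := hlaw.condExp_modelChange_sampleMean (h.size_ne_zero k)
    (measurable_prodMk_directions hX) (hf.measurable_gradEst ν γ)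
    (fun p ↦ hf.memLp_gradEst hd hν γ p.2 p.1)
    (h.integrable_integral_norm_gradEst_sq hd hf hν hX hX2 γ) c hgrad hgradX
  exact hmean

lemma integrable_modelChange_gradEst_objective (hd : 1 ≤ d) (h : Sampling μ P m T S)
    (hf : RegularLoss P f Lf Mf) (hν : 0 < ν) (hX : Measurable[past T S k] X) (hX2 : MemLp X 2 μ)
    (γ c : ℝ) :
    Integrable (fun ω ↦ modelChange c (gradient (objective P f) (X ω))
      (gradEst (objective P f) ν γ (T k ω) (X ω))) μ := by
  have hG := h.memLp_gradEst_objective hd hf hν hX hX2 γ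
  exact (integrable_inner_of_memLp_two
    ((hf.gradLipschitz_objective hd).memLp_gradient_comp hf.contDiff_objective hX2) hG).neg.add
    (hG.integrable_norm_pow'.const_mul _)

lemma integrable_modelChange_gradEst_subsampled (hd : 1 ≤ d) (h : Sampling μ P m T S)
    (hf : RegularLoss P f Lf Mf) (hν : 0 < ν) (hX : Measurable[past T S k] X) (hX2 : MemLp X 2 μ)
    (γ c : ℝ) :
    Integrable (fun ω ↦ modelChange c (gradient (objective P f) (X ω))
      (gradEst (subsampled f (S k ω)) ν γ (T k ω) (X ω))) μ := by
  have he := h.memLp_gradEst_subsampled hd hf hν hX hX2 γ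
  exact (integrable_inner_of_memLp_two
    ((hf.gradLipschitz_objective hd).memLp_gradient_comp hf.contDiff_objective hX2) he).neg.add
    (he.integrable_norm_pow'.const_mul _)

lemma condExp_modelChange_gradEst_objective_le (hd : 1 ≤ d) (hN : 1 ≤ N k)
    (h : Sampling μ P m T S) (hf : RegularLoss P f Lf Mf) (hν : 0 < ν) {MF : ℝ}
    (hMF : HessLipschitz (objective P f) MF) (hX : Measurable[past T S k] X)
    (hX2 : MemLp X 2 μ) :
    μ[fun ω ↦ modelChange (stepFactor m d (N k)) (gradient (objective P f) (X ω))
        (gradEst (objective P f) ν (scaling m d (N k)) (T k ω) (X ω)) | past T S k]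
      ≤ᵐ[μ] fun ω ↦ -(1 / 4) * ‖gradient (objective P f) (X ω)‖ ^ 2 + chi m d (N k) MF ν := by
  have hgrad : Measurable (gradient (objective P f)) :=
    (contDiff_gradient hf.contDiff_objective).continuous.measurable
  have hest := measurable_gradEst_apply (n := N k) hf.continuous_objective ν (scaling m d (N k))
  have hmodel : Measurable fun p : Vec d × (Fin (N k) → Vec d) ↦
      modelChange (stepFactor m d (N k)) (gradient (objective P f) p.1)
        (gradEst (objective P f) ν (scaling m d (N k)) p.2 p.1) := by
    unfold modelChange
    fun_prop
  have := Measure.isProbabilityMeasure_map (μ := μ) (h.measurable_T k).aemeasurable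
  refine ((h.hasCondLaw_directions k).condExp_prodMk hX hmodel.stronglyMeasurable
    (h.integrable_modelChange_gradEst_objective hd hf hν hX hX2 _ _)).trans_le
    (.of_forall fun ω ↦ ?_)
  simp only [gradEst_eq_dirSum, Kernel.const_apply]
  exact (h.law_T k).integral_modelChange_le hd hN
    (hMF.isDifferenceError_diffErr hd hf.contDiff_objective hν.ne' (X ω)) _

lemma condExp_modelChange_gradEst_subsampled_past (hd : 1 ≤ d) (h : Sampling μ P m T S)
    (hf : RegularLoss P f Lf Mf) (hν : 0 < ν) (hX : Measurable[past T S k] X) (hX2 : MemLp X 2 μ)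
    (γ c : ℝ) :
    μ[fun ω ↦ modelChange c (gradient (objective P f) (X ω))
        (gradEst (subsampled f (S k ω)) ν γ (T k ω) (X ω)) | past T S k]
      =ᵐ[μ] μ[fun ω ↦ modelChange c (gradient (objective P f) (X ω))
          (gradEst (objective P f) ν γ (T k ω) (X ω)) | past T S k]
        + (c / 8) • μ[fun ω ↦ estVar P f ν γ (T k ω) (X ω) / ((S k ω).1 : ℝ) | past T S k] := by
  have hmodel := h.integrable_modelChange_gradEst_objective hd hf hν hX hX2 γ c
  have hvar := h.integrable_estVar_div hd hf hν hX hX2 γ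
  refine (condExp_condExp_of_le le_sup_left (h.pastHalf_le k)).symm.trans ?_
  refine (condExp_congr_ae
    (h.condExp_modelChange_gradEst_subsampled hd hf hν hX hX2 γ c)).trans ?_
  exact (condExp_add hmodel (hvar.smul (c / 8)) _).trans
    (Filter.EventuallyEq.rfl.add (condExp_smul _ _ _))

lemma condExp_modelChange_gradEst_subsampled_le (hd : 1 ≤ d) (hN : 1 ≤ N k)
    (h : Sampling μ P m T S) (hf : RegularLoss P f Lf Mf) (hν : 0 < ν) {MF : ℝ}
    (hMF : HessLipschitz (objective P f) MF) (hX : Measurable[past T S k] X) (hX2 : MemLp X 2 μ)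
    {c : ℝ} (hc : 0 ≤ c) (hcθ : c * (1 + θ ^ 2) ≤ stepFactor m d (N k))
    (hnorm : μ[fun ω ↦ estVar P f ν (scaling m d (N k)) (T k ω) (X ω) / ((S k ω).1 : ℝ)
        | past T S k]
      ≤ᵐ[μ] θ ^ 2 • μ[fun ω ↦
        ‖gradEst (objective P f) ν (scaling m d (N k)) (T k ω) (X ω)‖ ^ 2 | past T S k]) :
    μ[fun ω ↦ modelChange c (gradient (objective P f) (X ω))
        (gradEst (subsampled f (S k ω)) ν (scaling m d (N k)) (T k ω) (X ω)) | past T S k]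
      ≤ᵐ[μ] fun ω ↦ -(1 / 4) * ‖gradient (objective P f) (X ω)‖ ^ 2 + chi m d (N k) MF ν := by
  set G := fun ω ↦ gradEst (objective P f) ν (scaling m d (N k)) (T k ω) (X ω)
  set D := fun (c : ℝ) ω ↦ modelChange c (gradient (objective P f) (X ω)) (G ω)
  have hD (c : ℝ) : Integrable (D c) μ :=
    h.integrable_modelChange_gradEst_objective hd hf hν hX hX2 _ c
  have hG : Integrable (fun ω ↦ ‖G ω‖ ^ 2) μ :=
    (h.memLp_gradEst_objective hd hf hν hX hX2 _).integrable_norm_pow'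
  have hinflate : μ[D c + (c / 8 * θ ^ 2) • fun ω ↦ ‖G ω‖ ^ 2 | past T S k]
      ≤ᵐ[μ] μ[D (stepFactor m d (N k)) | past T S k] := by
    refine condExp_mono ((hD c).add (hG.smul _)) (hD _) (.of_forall fun ω ↦ ?_)
    have := mul_le_mul_of_nonneg_right hcθ (sq_nonneg ‖G ω‖)
    simp only [D, modelChange, Pi.add_apply, Pi.smul_apply, smul_eq_mul]
    linarith
  have hsample := h.condExp_modelChange_gradEst_subsampled_past hd hf hν hX hX2
    (scaling m d (N k)) c
  filter_upwards [hsample, hnorm, hinflate,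
    condExp_add (hD c) (hG.smul (c / 8 * θ ^ 2)) (past T S k),
    condExp_smul (c / 8 * θ ^ 2) (fun ω ↦ ‖G ω‖ ^ 2) (past T S k),
    h.condExp_modelChange_gradEst_objective_le hd hN hf hν hMF hX hX2]
    with ω hsample hnorm hinflate hadd hsmul hdirections
  simp only [Pi.add_apply, Pi.smul_apply, smul_eq_mul] at hsample hnorm hadd hsmul
  have := mul_le_mul_of_nonneg_left hnorm (by positivity : 0 ≤ c / 8)
  linarith

theorem condExp_objective_sub_smul_le (hd : 1 ≤ d) (hN : 1 ≤ N k)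
    (h : Sampling μ P m T S) (hf : RegularLoss P f Lf Mf) (hν : 0 < ν) {LF MF a : ℝ}
    (hLF0 : 0 < LF) (hLF : GradLipschitz (objective P f) LF)
    (hMF : HessLipschitz (objective P f) MF) (hX : Measurable[past T S k] X) (hX2 : MemLp X 2 μ)
    (ha : 0 ≤ a) (ha' : a ≤ alphaBar m d (N k) θ LF)
    (hnorm : μ[fun ω ↦ estVar P f ν (scaling m d (N k)) (T k ω) (X ω) / ((S k ω).1 : ℝ)
        | past T S k]
      ≤ᵐ[μ] θ ^ 2 • μ[fun ω ↦
        ‖gradEst (objective P f) ν (scaling m d (N k)) (T k ω) (X ω)‖ ^ 2 | past T S k]) :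
    μ[fun ω ↦ objective P f
        (X ω - a • gradEst (subsampled f (S k ω)) ν (scaling m d (N k)) (T k ω) (X ω))
        | past T S k]
      ≤ᵐ[μ] fun ω ↦ objective P f (X ω) - a / 4 * ‖gradient (objective P f) (X ω)‖ ^ 2
        + a * chi m d (N k) MF ν := by
  have hstep : 4 * LF * a * (1 + θ ^ 2) ≤ stepFactor m d (N k) := by
    rw [alphaBar_eq_stepFactor_mul, Omega₁, mul_one_div, le_div_iff₀ (by positivity)] at ha'
    linarith
  set e := fun ω ↦ gradEst (subsampled f (S k ω)) ν (scaling m d (N k)) (T k ω) (X ω)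
  set D := fun ω ↦ modelChange (4 * LF * a) (gradient (objective P f) (X ω)) (e ω)
  have he : MemLp e 2 μ := h.memLp_gradEst_subsampled hd hf hν hX hX2 _
  have hD : Integrable D μ := h.integrable_modelChange_gradEst_subsampled hd hf hν hX hX2 _ _
  have hF := hLF.integrable_comp hf.contDiff_objective hX2
  have hpast : μ[fun ω ↦ objective P f (X ω) | past T S k] = fun ω ↦ objective P f (X ω) :=
    condExp_of_stronglyMeasurable (h.past_le k)
      (hf.continuous_objective.measurable.comp hX).stronglyMeasurable hF
  have htaylor : μ[fun ω ↦ objective P f (X ω - a • e ω) | past T S k]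
      ≤ᵐ[μ] μ[(fun ω ↦ objective P f (X ω)) + a • D | past T S k] :=
    condExp_mono (hLF.integrable_comp hf.contDiff_objective (hX2.sub (he.const_smul a)))
      (hF.add (hD.smul a)) (.of_forall fun ω ↦
        hLF.apply_sub_smul_le hf.contDiff_objective (X ω) (e ω) a)
  filter_upwards [htaylor, condExp_add hF (hD.smul a) (past T S k), condExp_smul a D (past T S k),
    h.condExp_modelChange_gradEst_subsampled_le hd hN hf hν hMF hX hX2 (by positivity) hstep hnorm]
    with ω htaylor hadd hsmul hmodel
  rw [hpast] at hadd
  simp only [Pi.add_apply, Pi.smul_apply, smul_eq_mul] at hadd hsmul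
  have := mul_le_mul_of_nonneg_left hmodel ha
  linarith

end Sampling

end Descent

section Iterates

variable {d : ℕ} {Ω Ξ : Type*} [MeasurableSpace Ξ] {N : ℕ → ℕ} {P : Measure Ξ}
  {m : Scheme} {T : (k : ℕ) → Ω → Fin (N k) → Vec d} {S : ℕ → Ω → Sample Ξ} {f : Vec d → Ξ → ℝ}
  {Lf Mf ν θ : ℝ} {α : ℕ → ℝ} {x₀ : Vec d}

lemma past_le_past_succ (T : (k : ℕ) → Ω → Fin (N k) → Vec d) (S : ℕ → Ω → Sample Ξ) (k : ℕ) :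
    past T S k ≤ past T S (k + 1) :=
  iSup_le fun j ↦ le_iSup (fun j : Fin (k + 1) ↦ MeasurableSpace.comap (T j) inferInstance ⊔
    MeasurableSpace.comap (S j) inferInstance) j.castSucc

lemma measurable_prodMk_past_succ (T : (k : ℕ) → Ω → Fin (N k) → Vec d) (S : ℕ → Ω → Sample Ξ)
    (k : ℕ) : Measurable[past T S (k + 1)] fun ω ↦ (T k ω, S k ω) := by
  have hle := le_iSup (fun j : Fin (k + 1) ↦ MeasurableSpace.comap (T j) inferInstance ⊔
    MeasurableSpace.comap (S j) inferInstance) (Fin.last k)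
  exact (measurable_iff_comap_le.2 (le_sup_left.trans hle)).prodMk
    (measurable_iff_comap_le.2 (le_sup_right.trans hle))

lemma RegularLoss.measurable_iter (hf : RegularLoss P f Lf Mf) (k : ℕ) :
    Measurable[past T S k] (iter m f ν α T S x₀ k) := by
  induction k with
  | zero => exact measurable_const
  | succ k ih =>
    have hX : Measurable[past T S (k + 1)] (iter m f ν α T S x₀ k) :=
      ih.mono (past_le_past_succ T S k) le_rfl
    have hTS := measurable_prodMk_past_succ T S k
    have hest : Measurable fun p : (Vec d × (Fin (N k) → Vec d)) × Sample Ξ ↦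
        gradEst (subsampled f p.2) ν (scaling m d (N k)) p.1.2 p.1.1 := by
      simp only [gradEst_subsampled]
      exact measurable_sampleMean (hf.measurable_gradEst ν _)
    have hstep := hest.comp ((hX.prodMk hTS.fst).prodMk hTS.snd)
    exact hX.sub (hstep.const_smul (α k))

variable [mΩ : MeasurableSpace Ω] {μ : Measure Ω} [IsProbabilityMeasure μ]
  [IsProbabilityMeasure P]

namespace Sampling

lemma memLp_iter (hd : 1 ≤ d) (h : Sampling μ P m T S) (hf : RegularLoss P f Lf Mf) (hν : 0 < ν)
    (k : ℕ) : MemLp (iter m f ν α T S x₀ k) 2 μ := by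
  induction k with
  | zero => exact memLp_const x₀
  | succ k ih =>
    have he := h.memLp_gradEst_subsampled hd hf hν (hf.measurable_iter k) ih (scaling m d (N k))
    exact ih.sub (he.const_smul (α k))

lemma gT_ae_eq (hd : 1 ≤ d) (h : Sampling μ P m T S) (hf : RegularLoss P f Lf Mf) (hν : 0 < ν)
    (k : ℕ) :
    gT μ m f ν α T S x₀ k =ᵐ[μ] fun ω ↦
      gradEst (objective P f) ν (scaling m d (N k)) (T k ω) (iter m f ν α T S x₀ k ω) :=
  h.condExp_gradEst_subsampled hd hf hν (hf.measurable_iter k) (h.memLp_iter hd hf hν k) _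

lemma condExp_estVar_div_le (hd : 1 ≤ d) (h : Sampling μ P m T S) (hf : RegularLoss P f Lf Mf)
    (hν : 0 < ν) {k : ℕ} (hnorm : NormCondition μ P m f ν α T S x₀ θ k) :
    μ[fun ω ↦ estVar P f ν (scaling m d (N k)) (T k ω) (iter m f ν α T S x₀ k ω)
        / ((S k ω).1 : ℝ) | past T S k]
      ≤ᵐ[μ] θ ^ 2 • μ[fun ω ↦ ‖gradEst (objective P f) ν (scaling m d (N k)) (T k ω)
        (iter m f ν α T S x₀ k ω)‖ ^ 2 | past T S k] := by
  have hX := hf.measurable_iter (m := m) (T := T) (S := S) (ν := ν) (α := α) (x₀ := x₀) k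
  have hX2 := h.memLp_iter (α := α) (x₀ := x₀) hd hf hν k
  have hmean := h.gT_ae_eq (α := α) (x₀ := x₀) hd hf hν k
  have hvar := h.integrable_estVar hd hf hν hX hX2 (scaling m d (N k))
  have hdiv := h.integrable_estVar_div hd hf hν hX hX2 (scaling m d (N k))
  have hestVar : (fun ω ↦ ∫ ζ, ‖gradEst (fun y ↦ f y ζ) ν (scaling m d (N k)) (T k ω)
        (iter m f ν α T S x₀ k ω) - gT μ m f ν α T S x₀ k ω‖ ^ 2 ∂P)
      =ᵐ[μ] fun ω ↦ estVar P f ν (scaling m d (N k)) (T k ω) (iter m f ν α T S x₀ k ω) := by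
    filter_upwards [hmean] with ω hω
    rw [hω, estVar]
  simp only [div_eq_mul_inv] at hdiv ⊢
  filter_upwards [hnorm, condExp_congr_ae (m := past T S k) hestVar,
    condExp_congr_ae (m := past T S k) (hmean.fun_comp (‖·‖ ^ 2)),
    condExp_mul_of_stronglyMeasurable_right (h.measurable_inv_size k).stronglyMeasurable hdiv hvar]
    with ω hnorm hestVar hsq hpull
  rw [hestVar, div_eq_mul_inv] at hnorm
  rw [Pi.smul_apply, smul_eq_mul]
  exact hpull.trans_le (hnorm.trans_eq (congrArg (θ ^ 2 * ·) hsq))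

end Sampling

end Iterates

end CFD

open CFD in
theorem lemma1_general {Ω Ξ : Type*} [MeasurableSpace Ω] [MeasurableSpace Ξ]
    (μ : Measure Ω) [IsProbabilityMeasure μ]
    (P : Measure Ξ) [IsProbabilityMeasure P]
    (m : Scheme) {d : ℕ} (hd : 1 ≤ d)
    (f : Vec d → Ξ → ℝ) (Lf Mf : ℝ)
    (hf : RegularLoss P f Lf Mf) (ν : ℝ) (hν : 0 < ν) (θ : ℝ)
    (N : ℕ → ℕ) (hN : ∀ k, 1 ≤ N k)
    (T : (k : ℕ) → Ω → Fin (N k) → Vec d) (S : ℕ → Ω → Sample Ξ)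
    (hsampling : Sampling μ P m T S)
    (α : ℕ → ℝ) (x₀ : Vec d) :
    (GradLipschitz (objective P f) Lf ∧ HessLipschitz (objective P f) Mf) ∧
    ∀ LF MF : ℝ, 0 < LF → GradLipschitz (objective P f) LF →
      HessLipschitz (objective P f) MF →
      ∀ k : ℕ, NormCondition μ P m f ν α T S x₀ θ k →
        0 < alphaBar m d (N k) θ LF ∧
        (0 < MF → 0 < chi m d (N k) MF ν) ∧
        (0 < α k → α k ≤ alphaBar m d (N k) θ LF →
          Integrable (fun ω ↦ objective P f (iter m f ν α T S x₀ (k + 1) ω)) μ ∧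
          μ[fun ω ↦ objective P f (iter m f ν α T S x₀ (k + 1) ω) | past T S k]
            ≤ᵐ[μ] fun ω ↦
              objective P f (iter m f ν α T S x₀ k ω)
                - α k / 4 * ‖gradient (objective P f) (iter m f ν α T S x₀ k ω)‖ ^ 2
                + α k * chi m d (N k) MF ν) := by
  refine ⟨⟨hf.gradLipschitz_objective hd, hf.hessLipschitz_objective hd⟩, ?_⟩
  intro LF MF hLF0 hLF hMF k hnorm
  refine ⟨alphaBar_pos m hd (hN k) θ hLF0, fun hMF0 ↦ chi_pos m hd (N k) hMF0 hν, ?_⟩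
  intro hα hα'
  have hiter := hsampling.memLp_iter (α := α) (x₀ := x₀) hd hf hν
  exact ⟨hLF.integrable_comp hf.contDiff_objective (hiter (k + 1)),
    hsampling.condExp_objective_sub_smul_le hd (hN k) hf hν hLF0 hLF hMF (hf.measurable_iter k)
      (hiter k) hα.le hα' (hsampling.condExp_estVar_div_le hd hf hν hnorm)⟩

theorem lemma1 {Ω Ξ : Type*} [MeasurableSpace Ω] [MeasurableSpace Ξ]
    (μ : MeasureTheory.Measure Ω) [MeasureTheory.IsProbabilityMeasure μ]
    (P : MeasureTheory.Measure Ξ) [MeasureTheory.IsProbabilityMeasure P]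
    (m : CFD.Scheme) {d : ℕ} (hd : 1 ≤ d)
    (f : CFD.Vec d → Ξ → ℝ) (Lf Mf : ℝ)
    (hf : CFD.WellPosed P f) (hsmooth : CFD.Smoothness P f Lf Mf)
    (hvar : CFD.BoundedVariance P f)
    (ν : ℝ) (hν : 0 < ν) (θ : ℝ) (hθ : 0 < θ)
    (N : ℕ → ℕ) (hN : ∀ k, 1 ≤ N k)
    (T : (k : ℕ) → Ω → Fin (N k) → CFD.Vec d) (S : ℕ → Ω → CFD.Sample Ξ)
    (hsampling : CFD.Sampling μ P m T S)
    (α : ℕ → ℝ) (x₀ : CFD.Vec d) :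
    -- `F` inherits the Lipschitz constants of the functions `f(·, ζ)`
    (CFD.GradLipschitz (CFD.objective P f) Lf ∧ CFD.HessLipschitz (CFD.objective P f) Mf) ∧
    -- the descent inequality, for all Lipschitz constants `LF`, `MF` of `∇F`, `∇²F`
    ∀ LF MF : ℝ, 0 < LF → CFD.GradLipschitz (CFD.objective P f) LF →
      CFD.HessLipschitz (CFD.objective P f) MF →
      ∀ k : ℕ, CFD.NormCondition μ P m f ν α T S x₀ θ k →
        0 < CFD.alphaBar m d (N k) θ LF ∧
        (0 < MF → 0 < CFD.chi m d (N k) MF ν) ∧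
        (0 < α k → α k ≤ CFD.alphaBar m d (N k) θ LF →
          MeasureTheory.Integrable
            (fun ω => CFD.objective P f (CFD.iter m f ν α T S x₀ (k + 1) ω)) μ ∧
          μ[fun ω => CFD.objective P f (CFD.iter m f ν α T S x₀ (k + 1) ω) | CFD.past T S k]
            ≤ᵐ[μ] fun ω =>
              CFD.objective P f (CFD.iter m f ν α T S x₀ k ω)
                - α k / 4 * ‖gradient (CFD.objective P f) (CFD.iter m f ν α T S x₀ k ω)‖ ^ 2
                + α k * CFD.chi m d (N k) MF ν) := by
  obtain ⟨β₁, β₂, -, -, hvar⟩ := hvar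
  exact lemma1_general μ P m hd f Lf Mf
    ⟨hf, hsmooth.contDiff_objective, hsmooth.contDiff, hsmooth.gradLipschitz,
      hsmooth.hessLipschitz, (hvar 0).1⟩ ν hν θ N hN T S hsampling α x₀
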